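/- Let $l\ge 2$ and $r,u\ge 1$ be integers, $\gamma>0$ a non-integer real number, and put $\Omega=[-1,1]^l$, $\Gamma=\partial\Omega$, $s=r+\lceil\gamma\rceil$, $\zeta=\lceil\gamma\rceil-\gamma$, $\mu=1+\gamma-\lceil\gamma\rceil$, $v=s/(s-\gamma)$. Let $d(t,\Gamma)$ be the $\ell_\infty$-distance from $t$ to $\Gamma$. Let $Q^u_{r\gamma}(\Omega,1)$ be the class of all $f\in C^r(\Omega)$ whose partial derivatives $D^\alpha f$ of orders up to $s$ exist in $\Omega\setminus\Gamma$ and which satisfy $$|D^\alpha f(t)|\le 1\quad (t\in\Omega,\ 0\le|\alpha|\le r),\qquad |D^\alpha f(t)|\le \frac{1+|\ln^u d(t,\Gamma)|}{d(t,\Gamma)^{|\alpha|-r-\zeta}}\quad (t\in\Omega\setminus\Gamma,\ r<|\alpha|\le s).$$ For a subset $X$ of $C=C(\Omega)$ with the maximum norm, let $d_n(X,C)=\inf_{L}\sup_{x\in X}\inf_{y\in L}\|x-y\|$ be its Kolmogorov width, where $L$ runs over the $n$-dimensional linear subspaces of $C$. Then there is a constant $c>0$, which depends only on $l,r,u,\gamma$,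 such that the following hold. 1. If $v<l/(l-1)$, then $d_n(Q^u_{r\gamma}(\Omega,1),C)\le c\,n^{-s/l}$ for all $n\ge 1$. 2. If $v=l/(l-1)$ and $\frac{lu}{r+1-\mu}\ge\frac{ul}{s}+1$, then $d_n(Q^u_{r\gamma}(\Omega,1),C)\le c\,n^{-s/l}(\ln n)^{us/(r+1-\mu)}$ for all $n\ge 2$. 3. If $v=l/(l-1)$ and $\frac{lu}{r+1-\mu}<\frac{ul}{s}+1$, then $d_n(Q^u_{r\gamma}(\Omega,1),C)\le c\,n^{-s/l}(\ln n)^{(ul+s)/l}$ for all $n\ge 2$. Moreover, each of these bounds (for the same $n$) is attained by continuous local splines: there are a partition of $\Omega$ into at most $n$ boxes with edges parallel to the axes, a set of at most $n$ nodes in $\Omega$, and a linear map $S:C(\Omega)\to C(\Omega)$ such that, for every $f\in C(\Omega)$, the continuous function $Sf$ is on each closed box a polynomial of degree at most $s-1$ in each variable, which depends only on the values of $f$ at the nodes lying in the closed boxes that meet this box, and such that $\|f-Sf\|_{C(\Omega)}$ is at most the right-hand side of the bound for all $f\in Q^u_{r\gamma}(\Omega,1)$. -/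

import Mathlib

open scoped ENNReal

noncomputable section

/-- The Kolmogorov width `d_n(X, B)`: the infimum, over all `n`-dimensional linear subspaces `L` of
`B`, of the largest distance from a point of `X` to `L` (with values in `[0, ∞]`, so that no
convention about unbounded sets or infima over the empty set is involved). -/
def kolmogorovWidth {B : Type*} [NormedAddCommGroup B] [NormedSpace ℝ B] (n : ℕ) (X : Set B) :
    ℝ≥0∞ :=
  ⨅ (L : Submodule ℝ B) (_ : FiniteDimensional ℝ L ∧ Module.finrank ℝ L = n),
    ⨆ x ∈ X, Metric.infEDist x (L : Set B)

/-- The closed cube `Ω = [-1,1]^l`; the metric of `Fin l → ℝ` is the `l_∞` metric. -/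
abbrev cube (l : ℕ) : Set (Fin l → ℝ) := Set.Icc (-1) 1

/-- `d(t, Γ)`: the `l_∞` distance from `t` to the boundary `Γ` of the cube. -/
def distBoundary {l : ℕ} (t : Fin l → ℝ) : ℝ := Metric.infDist t (frontier (cube l))

/-- The partial derivative in the direction of the `i`-th coordinate, relative to the cube
(hence one-sided at the faces `t i = -1` and `t i = 1`, and the usual one if `-1 < t i < 1`). -/
def cubePartial {l : ℕ} (i : Fin l) (g : (Fin l → ℝ) → ℝ) : (Fin l → ℝ) → ℝ :=
  fun t => derivWithin (fun τ => g (Function.update t i τ)) (Set.Icc (-1) 1) (t i)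

/-- Iterated partial derivatives: the list `[i₁, …, i_k]` stands for `∂_{i₁} ⋯ ∂_{i_k}`,
a derivative of order `k`. -/
def iterPartial {l : ℕ} (g : (Fin l → ℝ) → ℝ) : List (Fin l) → (Fin l → ℝ) → ℝ
  | [] => g
  | i :: L => cubePartial i (iterPartial g L)

/-- The conditions that define `Q^u_{rγ}(Ω,1)`, with `s = r + ⌈γ⌉` and `ζ = ⌈γ⌉ - γ`.
Only the values of `g` on the cube matter. Each derivative `D^v` is written as an iterated partial
derivative, and the conditions are imposed for every order of differentiation. -/
structure IsInClassQ (l r u : ℕ) (γ : ℝ) (g : (Fin l → ℝ) → ℝ) : Prop where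
  /-- `g ∈ C^r(Ω)` -/
  contDiffOn : ContDiffOn ℝ r g (cube l)
  /-- `|D^v g| ≤ 1` on `Ω` for `|v| ≤ r` -/
  bound_low : ∀ L : List (Fin l), L.length ≤ r → ∀ t ∈ cube l, |iterPartial g L t| ≤ 1
  /-- the partial derivatives of all orders up to `s` exist in `Ω \ Γ` -/
  exists_partial : ∀ L : List (Fin l), L.length < r + ⌈γ⌉₊ →
    ∀ t ∈ cube l \ frontier (cube l), ∀ i : Fin l,
      DifferentiableAt ℝ (fun τ => iterPartial g L (Function.update t i τ)) (t i)
  /-- `|D^v g| ≤ (1 + |ln^u d(t,Γ)|) / d(t,Γ)^{|v|-r-ζ}` on `Ω \ Γ` for `r < |v| ≤ s` -/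
  bound_high : ∀ L : List (Fin l), r < L.length → L.length ≤ r + ⌈γ⌉₊ →
    ∀ t ∈ cube l \ frontier (cube l),
      |iterPartial g L t| ≤ (1 + |Real.log (distBoundary t) ^ u|) /
        distBoundary t ^ ((L.length : ℝ) - r - ((⌈γ⌉₊ : ℝ) - γ))

/-- The class `Q^u_{rγ}(Ω,1)` as a subset of the Banach space `C(Ω)`. -/
def classQ (l r u : ℕ) (γ : ℝ) : Set C(cube l, ℝ) :=
  {f | ∃ g : (Fin l → ℝ) → ℝ, (∀ t : cube l, g t = f t) ∧ IsInClassQ l r u γ g}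

/-- The cube as a box. -/
def cubeBox (l : ℕ) : BoxIntegral.Box (Fin l) where
  lower := -1
  upper := 1
  lower_lt_upper := fun i => by
    simp only [Pi.neg_apply, Pi.one_apply]
    norm_num

/-- A continuous spline on a family `π` of boxes: a continuous function on the cube that coincides
on every closed box of `π` with a polynomial of degree at most `m` in each variable. -/
def IsContinuousSpline {l : ℕ} (π : BoxIntegral.Prepartition (cubeBox l)) (m : ℕ)
    (g : C(cube l, ℝ)) : Prop :=
  ∀ J ∈ π, ∃ p : MvPolynomial (Fin l) ℝ, (∀ i, p.degreeOf i ≤ m) ∧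
    ∀ t : cube l, (t : Fin l → ℝ) ∈ BoxIntegral.Box.Icc J →
      g t = MvPolynomial.eval (t : Fin l → ℝ) p

/-- `S` is a method of approximation by continuous local splines with at most `n` nodes: the cube is
partitioned into at most `n` boxes and at most `n` nodes are fixed such that every `S f` is a
continuous spline on this partition, of degree at most `m` in each variable, and `S f` on a box
depends linearly, and only, on the values of `f` at the nodes in the boxes touching it. -/
def IsLocalSplineMethod {l : ℕ} (m n : ℕ) (S : C(cube l, ℝ) →ₗ[ℝ] C(cube l, ℝ)) : Prop :=
  ∃ (π : BoxIntegral.Prepartition (cubeBox l)) (T : Finset (cube l)),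
    π.IsPartition ∧ π.boxes.card ≤ n ∧ T.card ≤ n ∧
    (∀ f, IsContinuousSpline π m (S f)) ∧
    ∀ J ∈ π, ∀ f g : C(cube l, ℝ),
      (∀ J' ∈ π, (BoxIntegral.Box.Icc J' ∩ BoxIntegral.Box.Icc J).Nonempty →
        ∀ x ∈ T, (x : Fin l → ℝ) ∈ BoxIntegral.Box.Icc J' → f x = g x) →
      ∀ t : cube l, (t : Fin l → ℝ) ∈ BoxIntegral.Box.Icc J → S f t = S g t

/-- The number `ε` bounds both the Kolmogorov width `d_n(Q^u_{rγ}(Ω,1), C)` and the uniform error on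
`Q^u_{rγ}(Ω,1)` of some method of approximation by continuous local splines with at most `n` nodes,
of degree at most `m` in each variable. -/
def WidthAndSplineBound (l r u : ℕ) (γ : ℝ) (m n : ℕ) (ε : ℝ) : Prop :=
  kolmogorovWidth n (classQ l r u γ) ≤ ENNReal.ofReal ε ∧
  ∃ S : C(cube l, ℝ) →ₗ[ℝ] C(cube l, ℝ), IsLocalSplineMethod m n S ∧
    ∀ f ∈ classQ l r u γ, ‖f - S f‖ ≤ ε

end

open scoped ENNReal

/-! The bound comes from an explicit mesh graded towards the boundary. Cut the cube into dyadic
shells: on shell k < K the distance to Γ is of order 2^-k, and shell K reaches Γ. Shell k carries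
cubic cells of edge 2^-p_k, where s p_k is about (s-γ')K + γ'k and γ' ≥ γ is a free parameter. The
bound on derivatives of order s gives interpolation of degree s-1 an error of order 2^(-s p_k)
(k+1)^u 2^(γk), hence at most 2^(-(s-γ')K) (k+1)^u 2^(-(γ'-γ)k) up to a constant
(`IsInClassQ.abs_sub_interp_le_inner`). On shell K derivatives of order s may blow up. There the
bound on derivatives of order r+1, summed along dilations towards the boundary, gives those of order
r a modulus of continuity (K+1)^u 2^(-ζK), and r+ζ = s-γ leads to the same estimate
(`IsInClassQ.abs_sub_interp_le_outer`).

The number of cells is of order ρ^K ∑ σ^k with ρ = 2^(l(s-γ')/s) and σ = 2^(lγ'/s-1), while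
2^(-(s-γ')K) = (ρ^K)^(-s/l). The condition v < l/(l-1) says lγ < s: any γ' with γ < γ' < s/l makes σ
< 1 and absorbs (k+1)^u. The condition v = l/(l-1) says lγ = s: with γ' = γ one has σ = 1, about
(K+1)ρ^K cells and a factor (K+1)^u in the error, that is, n^(-s/l) (ln n)^(u+s/l). Both logarithmic
bounds follow, since in the first the stated exponent is at least u+s/l, and in the second it equals
u+s/l.

Continuity across shells is obtained by replacing the nodal values of the finer grid, in the region
of the coarser ones, by values of the coarser spline (`gradedSpline`). Because every shell is at
least two cells thick, this correction reaches only one shell back, which keeps the method local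
(`gradedSpline_congr`) and stops errors from accumulating with K (`abs_sub_gradedSpline_le`).
Finally, such an operator factors through its at most n nodal values, so its range bounds the width.
-/

noncomputable section

/-! ### One-dimensional piecewise Lagrange interpolation at integer nodes. -/

section NodalBasis

/-- The Lagrange basis polynomial of the integer node `m` on the cell `[qc, qc + q]`. -/
def nodalBasis (q : ℕ) (c m : ℤ) : Polynomial ℝ :=
  if m ∈ Finset.Icc (q * c) (q * c + q) then
    Lagrange.basis (Finset.Icc (q * c) (q * c + q)) (fun b : ℤ => (b : ℝ)) m
  else 0

/-- The continuous, piecewise polynomial nodal function of the integer node `m`, with cells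
`[qc, qc + q]`. -/
def hat (q : ℕ) (m : ℤ) (y : ℝ) : ℝ := (nodalBasis q ⌊y / q⌋ m).eval y

lemma card_cell_nodes (q : ℕ) (c : ℤ) : (Finset.Icc (q * c) (q * c + q) : Finset ℤ).card = q + 1 := by
  rw [Int.card_Icc]; omega

lemma natDegree_nodalBasis_le (q : ℕ) (c m : ℤ) : (nodalBasis q c m).natDegree ≤ q := by
  unfold nodalBasis
  split_ifs with h
  · rw [Lagrange.natDegree_basis (Int.cast_injective.injOn) h, card_cell_nodes]; simp
  · simp

lemma nodalBasis_eval_int {q : ℕ} {c n : ℤ} (m : ℤ) (hn : n ∈ Finset.Icc (q * c) (q * c + q)) :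
    (nodalBasis q c m).eval (n : ℝ) = if m = n then 1 else 0 := by
  unfold nodalBasis
  split_ifs with h h' h'
  · subst h'
    exact Lagrange.eval_basis_self (v := fun b : ℤ => (b : ℝ)) (Int.cast_injective.injOn) h
  · exact Lagrange.eval_basis_of_ne (v := fun b : ℤ => (b : ℝ)) h' hn
  · subst h'; exact absurd hn h
  · simp

/-- The floor in `hat` selects one of the two cells at a common endpoint. The choice is immaterial,
because that endpoint is a node of both cells and both polynomials take the same value 0 or 1 there.
-/
lemma hat_eq {q : ℕ} (hq : 0 < q) {c : ℤ} {y : ℝ} (m : ℤ) (h1 : (q * c : ℝ) ≤ y)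
    (h2 : y ≤ q * c + q) : hat q m y = (nodalBasis q c m).eval y := by
  have hq' : (0 : ℝ) < q := by exact_mod_cast hq
  rcases h2.lt_or_eq with h2 | h2
  · have : ⌊y / q⌋ = c := by
      rw [Int.floor_eq_iff, le_div_iff₀ hq', div_lt_iff₀ hq']
      constructor <;> nlinarith
    rw [hat, this]
  · have hf : ⌊y / q⌋ = c + 1 := by
      rw [Int.floor_eq_iff, le_div_iff₀ hq', div_lt_iff₀ hq']
      push_cast
      constructor <;> nlinarith
    have hy : y = ((q * c + q : ℤ) : ℝ) := by rw [h2]; push_cast; ring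
    rw [hat, hf, hy, nodalBasis_eval_int, nodalBasis_eval_int]
    · rw [Finset.mem_Icc]; constructor <;> nlinarith
    · rw [Finset.mem_Icc]; constructor <;> nlinarith

lemma hat_eq_zero {q : ℕ} (hq : 0 < q) {c : ℤ} {y : ℝ} {m : ℤ} (h1 : (q * c : ℝ) ≤ y)
    (h2 : y ≤ q * c + q) (hm : m ∉ Finset.Icc (q * c) (q * c + q)) : hat q m y = 0 := by
  rw [hat_eq hq m h1 h2, nodalBasis, if_neg hm, Polynomial.eval_zero]

lemma exists_cell {q : ℕ} (hq : 0 < q) (y : ℝ) : ∃ c : ℤ, (q * c : ℝ) ≤ y ∧ y ≤ q * c + q := by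
  have hq' : (0 : ℝ) < q := by exact_mod_cast hq
  refine ⟨⌊y / q⌋, ?_, ?_⟩
  · rw [mul_comm, ← le_div_iff₀ hq']; exact Int.floor_le _
  · have := (Int.lt_floor_add_one (y / q)).le
    rw [div_le_iff₀ hq'] at this
    nlinarith

/-- The closed cells form a locally finite closed cover, and by `hat_eq` the function is a
polynomial on each of them. -/
lemma continuous_hat {q : ℕ} (hq : 0 < q) (m : ℤ) : Continuous (hat q m) := by
  have hq' : (1 : ℝ) ≤ q := by exact_mod_cast hq
  have hfin : LocallyFinite (fun c : ℤ => Set.Icc (q * c : ℝ) (q * c + q)) := by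
    intro y
    refine ⟨Set.Ioo (y - 1) (y + 1), Ioo_mem_nhds (by linarith) (by linarith), ?_⟩
    refine (Set.finite_Icc (⌊(y - 1) / q⌋ - 1) ⌈(y + 1) / q⌉).subset ?_
    rintro c ⟨x, ⟨hx1, hx2⟩, hx3, hx4⟩
    constructor
    · have : (y - 1) / q ≤ c + 1 := by rw [div_le_iff₀ (by linarith)]; nlinarith
      have h := (Int.floor_le ((y - 1) / q)).trans this
      have h : ⌊(y - 1) / q⌋ ≤ c + 1 := by exact_mod_cast h
      omega
    · have : (c : ℝ) ≤ (y + 1) / q := by rw [le_div_iff₀ (by linarith)]; nlinarith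
      exact_mod_cast this.trans (Int.le_ceil _)
  refine hfin.continuous ?_ (fun c => isClosed_Icc) (fun c => ?_)
  · refine Set.eq_univ_of_forall fun y => ?_
    obtain ⟨c, h1, h2⟩ := exists_cell hq y
    exact Set.mem_iUnion.2 ⟨c, h1, h2⟩
  · exact (nodalBasis q c m).continuous.continuousOn.congr fun y hy => hat_eq hq m hy.1 hy.2

lemma sum_hat_eq_sum_cell {q : ℕ} (hq : 0 < q) {c : ℤ} {y : ℝ} (h1 : (q * c : ℝ) ≤ y)
    (h2 : y ≤ q * c + q) {M : Finset ℤ} (hM : Finset.Icc (q * c) (q * c + q) ⊆ M) (φ : ℤ → ℝ) :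
    ∑ m ∈ M, hat q m y * φ m = ∑ m ∈ Finset.Icc (q * c) (q * c + q), hat q m y * φ m :=
  (Finset.sum_subset hM fun m _ hm => by rw [hat_eq_zero hq h1 h2 hm, zero_mul]).symm

/-- Only the q + 1 nodes of the cell contribute, and Lagrange interpolation at them is exact in
degree q. -/
lemma sum_hat_mul_eval {q : ℕ} (hq : 0 < q) {c : ℤ} {y : ℝ} (h1 : (q * c : ℝ) ≤ y)
    (h2 : y ≤ q * c + q) {M : Finset ℤ} (hM : Finset.Icc (q * c) (q * c + q) ⊆ M)
    {R : Polynomial ℝ} (hR : R.natDegree ≤ q) :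
    ∑ m ∈ M, hat q m y * R.eval (m : ℝ) = R.eval y := by
  rw [sum_hat_eq_sum_cell hq h1 h2 hM (fun m => R.eval (m : ℝ))]
  have hdeg : R.degree < (Finset.Icc (q * c) (q * c + q) : Finset ℤ).card := by
    rw [card_cell_nodes]
    exact lt_of_le_of_lt Polynomial.degree_le_natDegree (by exact_mod_cast Nat.lt_succ_of_le hR)
  have key := Lagrange.eq_interpolate (v := fun b : ℤ => (b : ℝ))
    (Int.cast_injective.injOn) hdeg
  conv_rhs => rw [key, Lagrange.interpolate_apply, Polynomial.eval_finsetSum]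
  refine Finset.sum_congr rfl fun m hm => ?_
  rw [hat_eq hq m h1 h2, nodalBasis, if_pos hm, Polynomial.eval_mul, Polynomial.eval_C, mul_comm]

/-- A bound for the Lebesgue constant of the interpolation at `q + 1` equidistant nodes. -/
def lebesgueBound (q : ℕ) : ℝ := (q + 1) * q ^ q

lemma one_le_lebesgueBound {q : ℕ} (hq : 0 < q) : 1 ≤ lebesgueBound q := by
  have hq' : (1 : ℝ) ≤ q := by exact_mod_cast hq
  have : (1 : ℝ) ≤ q ^ q := one_le_pow₀ hq'
  unfold lebesgueBound
  nlinarith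

/-- Each of the q factors |y - b| / |m - b| has numerator at most q, and denominator at least 1
since the nodes are integers. -/
lemma abs_eval_nodalBasis_le {q : ℕ} {c : ℤ} {y : ℝ} (m : ℤ) (h1 : (q * c : ℝ) ≤ y)
    (h2 : y ≤ q * c + q) : |(nodalBasis q c m).eval y| ≤ (q : ℝ) ^ q := by
  unfold nodalBasis
  split_ifs with h
  · rw [Lagrange.basis, Polynomial.eval_prod, Finset.abs_prod]
    have hcard : ((Finset.Icc (q * c) (q * c + q) : Finset ℤ).erase m).card = q := by
      rw [Finset.card_erase_of_mem h, card_cell_nodes]; simp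
    conv_rhs => rw [← hcard]
    rw [← Finset.prod_const, hcard]
    refine Finset.prod_le_prod (fun _ _ => abs_nonneg _) fun b hb => ?_
    rw [Finset.mem_erase, Finset.mem_Icc] at hb
    obtain ⟨hbm, hb1, hb2⟩ := hb
    have hb1' : (q * c : ℝ) ≤ b := by exact_mod_cast hb1
    have hb2' : (b : ℝ) ≤ q * c + q := by exact_mod_cast hb2
    have hone : (1 : ℝ) ≤ |(m : ℝ) - b| := by
      have : (1 : ℤ) ≤ |m - b| := Int.one_le_abs (sub_ne_zero.2 (Ne.symm hbm))
      exact_mod_cast this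
    have hyb : |y - b| ≤ q := by rw [abs_le]; constructor <;> linarith
    simp only [Lagrange.basisDivisor, Polynomial.eval_mul, Polynomial.eval_C, Polynomial.eval_sub,
      Polynomial.eval_X, abs_mul, abs_inv]
    calc |(m : ℝ) - b|⁻¹ * |y - b| ≤ 1 * q :=
          mul_le_mul (inv_le_one_of_one_le₀ hone) hyb (abs_nonneg _) zero_le_one
      _ = q := one_mul _
  · simp

lemma sum_abs_hat_le {q : ℕ} (hq : 0 < q) (M : Finset ℤ) (y : ℝ) :
    ∑ m ∈ M, |hat q m y| ≤ lebesgueBound q := by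
  obtain ⟨c, h1, h2⟩ := exists_cell hq y
  calc ∑ m ∈ M, |hat q m y| ≤ ∑ m ∈ M ∪ Finset.Icc (q * c) (q * c + q), |hat q m y| :=
        Finset.sum_le_sum_of_subset_of_nonneg Finset.subset_union_left fun _ _ _ => abs_nonneg _
    _ = ∑ m ∈ Finset.Icc (q * c) (q * c + q), |hat q m y| :=
        (Finset.sum_subset Finset.subset_union_right fun m _ hm => by
          rw [hat_eq_zero hq h1 h2 hm, abs_zero]).symm
    _ ≤ ∑ m ∈ Finset.Icc (q * c) (q * c + q), (q : ℝ) ^ q :=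
        Finset.sum_le_sum fun m _ => by
          rw [hat_eq hq m h1 h2]; exact abs_eval_nodalBasis_le m h1 h2
    _ = lebesgueBound q := by
        rw [Finset.sum_const, card_cell_nodes, lebesgueBound, nsmul_eq_mul]; push_cast; ring

end NodalBasis

/-! ### Tensor product interpolation on uniform grids. -/

section TensorInterpolation

lemma natDegree_comp_C_mul_X_le (R : Polynomial ℝ) (a : ℝ) :
    (R.comp (Polynomial.C a * Polynomial.X)).natDegree ≤ R.natDegree := by
  refine Polynomial.natDegree_comp_le.trans ?_
  calc _ ≤ R.natDegree * 1 := Nat.mul_le_mul_left _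
        ((Polynomial.natDegree_C_mul_le _ _).trans Polynomial.natDegree_X_le)
    _ = _ := mul_one _

lemma sum_piFinset_const_succ {l : ℕ} (M : Finset ℤ) (H : (Fin (l + 1) → ℤ) → ℝ) :
    ∑ m ∈ Fintype.piFinset (fun _ : Fin (l + 1) => M), H m =
      ∑ a ∈ M, ∑ m ∈ Fintype.piFinset (fun _ : Fin l => M), H (Fin.cons a m) := by
  rw [← Finset.sum_product']
  refine Finset.sum_nbij' (fun m => (m 0, Fin.tail m)) (fun b => Fin.cons b.1 b.2) ?_ ?_ ?_ ?_ ?_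
  · intro m hm
    rw [Fintype.mem_piFinset] at hm
    simp only [Finset.mem_product, Fintype.mem_piFinset]
    exact ⟨hm 0, fun i => hm i.succ⟩
  · intro b hb
    simp only [Finset.mem_product, Fintype.mem_piFinset] at hb
    rw [Fintype.mem_piFinset]
    intro i
    refine Fin.cases ?_ (fun j => ?_) i
    · simpa using hb.1
    · simpa using hb.2 j
  · intro m _; simp
  · intro b _; simp
  · intro m _; simp

/-- The error of a tensor product of univariate linear formulas is controlled by the errors of these
formulas in the directions of the axes. -/
lemma abs_sub_tensor_sum_le {Λ E : ℝ} (hΛ : 1 ≤ Λ) (hE : 0 ≤ E) (M : Finset ℤ) (ν : ℤ → ℝ) :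
    ∀ {l : ℕ} (w : Fin l → ℤ → ℝ) (_ : ∀ i, ∑ m ∈ M, |w i m| ≤ Λ) (Q : Fin l → Set ℝ)
      (x : Fin l → ℝ) (_ : ∀ i, x i ∈ Q i) (_ : ∀ i, ∀ m ∈ M, w i m ≠ 0 → ν m ∈ Q i)
      (F : (Fin l → ℝ) → ℝ)
      (_ : ∀ z, (∀ j, z j ∈ Q j) → ∀ i, |F (Function.update z i (x i)) -
        ∑ m ∈ M, w i m * F (Function.update z i (ν m))| ≤ E),
      |F x - ∑ m ∈ Fintype.piFinset (fun _ : Fin l => M), (∏ i, w i (m i)) * F (fun i => ν (m i))| ≤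
        l * Λ ^ l * E
  | 0, w, _, Q, x, _, _, F, _ => by
      simp only [Fintype.piFinset_of_isEmpty, Finset.univ_unique, Finset.sum_singleton,
        Finset.univ_eq_empty, Finset.prod_empty, one_mul]
      exact (abs_eq_zero.2 (sub_eq_zero.2 (congrArg F (Subsingleton.elim _ _)))).le.trans
        (by positivity)
  | l + 1, w, hw, Q, x, hx, hQ, F, hF => by
      -- Replace the first coordinate by its nodes at cost E. The induction hypothesis then treats
      -- the remaining coordinates for each node of nonzero weight, and these errors enter with
      -- total weight at most Λ.
      have h0 := hF x hx 0
      rw [Function.update_eq_self] at h0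
      have hrec : ∀ a ∈ M, w 0 a ≠ 0 → |F (Function.update x 0 (ν a)) -
          ∑ m ∈ Fintype.piFinset (fun _ : Fin l => M), (∏ i, w (Fin.succ i) (m i)) *
            F (Fin.cons (ν a) (fun i => ν (m i)))| ≤ l * Λ ^ l * E := by
        intro a ha hwa
        have := abs_sub_tensor_sum_le hΛ hE M ν (fun i => w (Fin.succ i)) (fun i => hw _)
          (fun i => Q i.succ) (fun i => x i.succ) (fun i => hx _) (fun i m hm h => hQ _ m hm h)
          (fun z => F (Fin.cons (ν a) z)) (fun z hz i => by
            have := hF (Fin.cons (ν a) z) (fun j => by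
              refine Fin.cases ?_ (fun j => ?_) j
              · simpa using hQ 0 a ha hwa
              · simpa using hz j) i.succ
            simpa only [Fin.cons_update] using this)
        convert this using 4
        funext i
        refine Fin.cases ?_ (fun j => ?_) i <;> simp
      have hsplit : ∑ m ∈ Fintype.piFinset (fun _ : Fin (l + 1) => M),
            (∏ i, w i (m i)) * F (fun i => ν (m i)) =
          ∑ a ∈ M, w 0 a * ∑ m ∈ Fintype.piFinset (fun _ : Fin l => M),
            (∏ i, w (Fin.succ i) (m i)) * F (Fin.cons (ν a) (fun i => ν (m i))) := by
        rw [sum_piFinset_const_succ]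
        refine Finset.sum_congr rfl fun a _ => ?_
        rw [Finset.mul_sum]
        refine Finset.sum_congr rfl fun m _ => ?_
        rw [Fin.prod_univ_succ, mul_assoc]
        simp only [Fin.cons_zero, Fin.cons_succ]
        congr 3
        funext i
        refine Fin.cases ?_ (fun j => ?_) i <;> simp
      rw [hsplit]
      have hB : 0 ≤ l * Λ ^ l * E := by positivity
      have h1 : |∑ a ∈ M, w 0 a * F (Function.update x 0 (ν a)) -
          ∑ a ∈ M, w 0 a * ∑ m ∈ Fintype.piFinset (fun _ : Fin l => M),
            (∏ i, w (Fin.succ i) (m i)) * F (Fin.cons (ν a) (fun i => ν (m i)))| ≤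
          Λ * (l * Λ ^ l * E) := by
        rw [← Finset.sum_sub_distrib]
        calc _ ≤ ∑ a ∈ M, |w 0 a| * (l * Λ ^ l * E) := by
              refine (Finset.abs_sum_le_sum_abs _ _).trans (Finset.sum_le_sum fun a ha => ?_)
              rw [← mul_sub, abs_mul]
              by_cases hwa : w 0 a = 0
              · simp [hwa]
              · exact mul_le_mul_of_nonneg_left (hrec a ha hwa) (abs_nonneg _)
          _ ≤ Λ * (l * Λ ^ l * E) := by
              rw [← Finset.sum_mul]
              exact mul_le_mul_of_nonneg_right (hw 0) hB
      have hpow : (1 : ℝ) ≤ Λ ^ (l + 1) := one_le_pow₀ hΛ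
      calc _ ≤ E + Λ * (l * Λ ^ l * E) := (abs_sub_le _ _ _).trans (add_le_add h0 h1)
        _ ≤ Λ ^ (l + 1) * E + Λ * (l * Λ ^ l * E) := by nlinarith
        _ = ((l + 1 : ℕ) : ℝ) * Λ ^ (l + 1) * E := by push_cast; ring

/-- The closed cell with index `c` of the cubic grid with `G` cells per unit of length. -/
def gridCell {l : ℕ} (G : ℕ) (c : Fin l → ℤ) : Set (Fin l → ℝ) :=
  {x | ∀ i, (c i : ℝ) ≤ G * x i ∧ G * x i ≤ c i + 1}

/-- The nodes of the grid with `G` cells per unit of length, with `q + 1` nodes per edge. -/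
def gridNode {l : ℕ} (q G : ℕ) (m : Fin l → ℤ) : Fin l → ℝ := fun i => m i / (q * G)

/-- Piecewise polynomial interpolation, of degree `q` in each variable, on the cubic grid with `G`
cells per unit of length. -/
def interp {l : ℕ} (q G : ℕ) (F : (Fin l → ℝ) → ℝ) (x : Fin l → ℝ) : ℝ :=
  ∑ m ∈ Fintype.piFinset (fun _ : Fin l => Finset.Icc (-(q * G : ℤ)) (q * G)),
    (∏ i, hat q (m i) (q * G * x i)) * F (gridNode q G m)

variable {l q G : ℕ}

lemma interp_add (F F' : (Fin l → ℝ) → ℝ) (x : Fin l → ℝ) :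
    interp q G (F + F') x = interp q G F x + interp q G F' x := by
  simp only [interp, Pi.add_apply, mul_add, Finset.sum_add_distrib]

lemma interp_smul (a : ℝ) (F : (Fin l → ℝ) → ℝ) (x : Fin l → ℝ) :
    interp q G (a • F) x = a * interp q G F x := by
  simp only [interp, Pi.smul_apply, smul_eq_mul, Finset.mul_sum]
  exact Finset.sum_congr rfl fun _ _ => by ring

lemma continuous_interp (hq : 0 < q) (F : (Fin l → ℝ) → ℝ) : Continuous (interp q G F) := by
  unfold interp
  refine continuous_finsetSum _ fun m _ => Continuous.mul (continuous_finsetProd _ fun i _ => ?_)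
    continuous_const
  exact (continuous_hat hq _).comp (by fun_prop)

lemma mem_cell_nodes_iff (hq : 0 < q) (hG : 0 < G) {c m : ℤ} :
    m ∈ Finset.Icc (q * c) (q * c + q) ↔
      (c : ℝ) ≤ G * ((m : ℝ) / (q * G)) ∧ G * ((m : ℝ) / (q * G)) ≤ c + 1 := by
  have hq' : (0 : ℝ) < q := by exact_mod_cast hq
  have hG' : (0 : ℝ) < G := by exact_mod_cast hG
  have : (G : ℝ) * ((m : ℝ) / (q * G)) = m / q := by field_simp
  rw [this, le_div_iff₀ hq', div_le_iff₀ hq', Finset.mem_Icc]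
  constructor
  · rintro ⟨h1, h2⟩
    have h1 : (q * c : ℝ) ≤ m := by exact_mod_cast h1
    have h2 : (m : ℝ) ≤ q * c + q := by exact_mod_cast h2
    constructor <;> nlinarith
  · rintro ⟨h1, h2⟩
    constructor
    · have : ((c * q : ℤ) : ℝ) ≤ m := by exact_mod_cast h1
      have : c * q ≤ m := by exact_mod_cast this
      linarith
    · have : (m : ℝ) ≤ (((c + 1) * q : ℤ) : ℝ) := by exact_mod_cast h2
      have : m ≤ (c + 1) * q := by exact_mod_cast this
      linarith

lemma cell_bounds_scaled {c : ℤ} {t : ℝ} (h : (c : ℝ) ≤ G * t ∧ G * t ≤ c + 1) :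
    (q * c : ℝ) ≤ q * G * t ∧ q * G * t ≤ q * c + q := by
  have hq' : (0 : ℝ) ≤ q := by positivity
  constructor <;> nlinarith [mul_le_mul_of_nonneg_left h.1 hq', mul_le_mul_of_nonneg_left h.2 hq']

lemma mem_cell_of_hat_ne_zero (hq : 0 < q) (hG : 0 < G) {c m : ℤ} {t : ℝ}
    (h : (c : ℝ) ≤ G * t ∧ G * t ≤ c + 1) (hm : hat q m (q * G * t) ≠ 0) :
    (c : ℝ) ≤ G * ((m : ℝ) / (q * G)) ∧ G * ((m : ℝ) / (q * G)) ≤ c + 1 := by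
  rw [← mem_cell_nodes_iff hq hG]
  by_contra hcon
  exact hm (hat_eq_zero hq (cell_bounds_scaled h).1 (cell_bounds_scaled h).2 hcon)

/-- Stability and locality at once: weights of nodes outside the cell vanish, and the absolute
weights sum to a product of one-dimensional Lebesgue sums. With E = 0 this is `interp_congr`. -/
lemma abs_interp_sub_interp_le (hq : 0 < q) (hG : 0 < G) {c : Fin l → ℤ} {F F' : (Fin l → ℝ) → ℝ}
    {E : ℝ} (h : ∀ m : Fin l → ℤ, (∀ i, -(q * G : ℤ) ≤ m i ∧ m i ≤ q * G) →
      gridNode q G m ∈ gridCell G c → |F (gridNode q G m) - F' (gridNode q G m)| ≤ E)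
    (hE : 0 ≤ E) {x : Fin l → ℝ} (hx : x ∈ gridCell G c) :
    |interp q G F x - interp q G F' x| ≤ lebesgueBound q ^ l * E := by
  unfold interp
  rw [← Finset.sum_sub_distrib]
  calc _ ≤ ∑ m ∈ Fintype.piFinset (fun _ : Fin l => Finset.Icc (-(q * G : ℤ)) (q * G)),
        (∏ i, |hat q (m i) (q * G * x i)|) * E := by
        refine (Finset.abs_sum_le_sum_abs _ _).trans (Finset.sum_le_sum fun m hm => ?_)
        rw [← mul_sub, abs_mul, Finset.abs_prod]
        by_cases h0 : ∀ i, hat q (m i) (q * G * x i) ≠ 0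
        · refine mul_le_mul_of_nonneg_left (h m (fun i => ?_) fun i => ?_)
            (Finset.prod_nonneg fun _ _ => abs_nonneg _)
          · exact Finset.mem_Icc.1 (Fintype.mem_piFinset.1 hm i)
          · exact mem_cell_of_hat_ne_zero hq hG (hx i) (h0 i)
        · push Not at h0
          obtain ⟨i, hi⟩ := h0
          rw [Finset.prod_eq_zero (Finset.mem_univ i) (by rw [hi, abs_zero])]
          simp
    _ = (∏ i, ∑ m ∈ Finset.Icc (-(q * G : ℤ)) (q * G), |hat q m (q * G * x i)|) * E := by
        rw [← Finset.sum_mul, Finset.prod_univ_sum]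
    _ ≤ (∏ _i : Fin l, lebesgueBound q) * E := by
        refine mul_le_mul_of_nonneg_right (Finset.prod_le_prod (fun i _ => ?_) fun i _ => ?_) hE
        · exact Finset.sum_nonneg fun _ _ => abs_nonneg _
        · exact sum_abs_hat_le hq _ _
    _ = lebesgueBound q ^ l * E := by simp

lemma interp_congr (hq : 0 < q) (hG : 0 < G) {c : Fin l → ℤ} {F F' : (Fin l → ℝ) → ℝ}
    (h : ∀ m : Fin l → ℤ, (∀ i, -(q * G : ℤ) ≤ m i ∧ m i ≤ q * G) →
      gridNode q G m ∈ gridCell G c → F (gridNode q G m) = F' (gridNode q G m))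
    {x : Fin l → ℝ} (hx : x ∈ gridCell G c) : interp q G F x = interp q G F' x := by
  have := abs_interp_sub_interp_le hq hG (F := F) (F' := F') (E := 0)
    (fun m hm h' => by rw [h m hm h', sub_self, abs_zero]) le_rfl hx
  rw [mul_zero] at this
  exact sub_eq_zero.1 (abs_nonpos_iff.1 this)

/-- Lebesgue's inequality: the formula reproduces R, so only φ - R is interpolated. The bounds on c
place all nodes of the cell in the range of summation. -/
lemma abs_sub_sum_hat_le (hq : 0 < q) (hG : 0 < G) {c : ℤ} (hc : -(G : ℤ) ≤ c ∧ c < G) {φ : ℝ → ℝ}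
    {E : ℝ} {R : Polynomial ℝ} (hR : R.natDegree ≤ q)
    (h : ∀ t, (c : ℝ) ≤ G * t ∧ G * t ≤ c + 1 → |φ t - R.eval t| ≤ E) {t : ℝ}
    (ht : (c : ℝ) ≤ G * t ∧ G * t ≤ c + 1) :
    |φ t - ∑ m ∈ Finset.Icc (-(q * G : ℤ)) (q * G), hat q m (q * G * t) * φ (m / (q * G))| ≤
      (1 + lebesgueBound q) * E := by
  have hq' : (0 : ℝ) < q := by exact_mod_cast hq
  have hG' : (0 : ℝ) < G := by exact_mod_cast hG
  have hE : 0 ≤ E := (abs_nonneg _).trans (h t ht)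
  obtain ⟨h1, h2⟩ := cell_bounds_scaled (q := q) ht
  have hsub : Finset.Icc (q * c) (q * c + q) ⊆ Finset.Icc (-(q * G : ℤ)) (q * G) := by
    refine Finset.Icc_subset_Icc ?_ ?_ <;> nlinarith
  have hrep := sum_hat_mul_eval hq h1 h2 hsub
    (R := R.comp (Polynomial.C ((q * G : ℝ)⁻¹) * Polynomial.X)) ((natDegree_comp_C_mul_X_le _ _).trans hR)
  simp only [Polynomial.eval_comp, Polynomial.eval_mul, Polynomial.eval_C, Polynomial.eval_X]
    at hrep
  have ht' : ((q * G : ℝ)⁻¹) * (q * G * t) = t := by field_simp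
  rw [ht'] at hrep
  have hsum : |R.eval t - ∑ m ∈ Finset.Icc (-(q * G : ℤ)) (q * G),
      hat q m (q * G * t) * φ (m / (q * G))| ≤ lebesgueBound q * E := by
    rw [← hrep, ← Finset.sum_sub_distrib]
    calc _ ≤ ∑ m ∈ Finset.Icc (-(q * G : ℤ)) (q * G), |hat q m (q * G * t)| * E := by
          refine (Finset.abs_sum_le_sum_abs _ _).trans (Finset.sum_le_sum fun m _ => ?_)
          rw [← mul_sub, abs_mul]
          by_cases h0 : hat q m (q * G * t) = 0
          · simp [h0]
          · refine mul_le_mul_of_nonneg_left ?_ (abs_nonneg _)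
            rw [← div_eq_inv_mul, abs_sub_comm]
            exact h _ (mem_cell_of_hat_ne_zero hq hG ht h0)
      _ ≤ lebesgueBound q * E := by
          rw [← Finset.sum_mul]
          exact mul_le_mul_of_nonneg_right (sum_abs_hat_le hq _ _) hE
  calc _ ≤ E + lebesgueBound q * E := (abs_sub_le _ _ _).trans (add_le_add (h t ht) hsum)
    _ = _ := by ring

/-- The interpolation error is controlled by the approximability by polynomials along the axes. -/
lemma abs_sub_interp_le (hq : 0 < q) (hG : 0 < G) {c : Fin l → ℤ}
    (hc : ∀ i, -(G : ℤ) ≤ c i ∧ c i < G) {F : (Fin l → ℝ) → ℝ} {E : ℝ} (hE : 0 ≤ E)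
    (hF : ∀ z ∈ gridCell G c, ∀ i, ∃ R : Polynomial ℝ, R.natDegree ≤ q ∧
      ∀ t : ℝ, (c i : ℝ) ≤ G * t ∧ G * t ≤ c i + 1 → |F (Function.update z i t) - R.eval t| ≤ E)
    {x : Fin l → ℝ} (hx : x ∈ gridCell G c) :
    |F x - interp q G F x| ≤ l * lebesgueBound q ^ l * ((1 + lebesgueBound q) * E) := by
  have hΛ := one_le_lebesgueBound hq
  refine abs_sub_tensor_sum_le hΛ (by positivity) _ (fun m => (m : ℝ) / (q * G))
    (fun i m => hat q m (q * G * x i)) (fun i => sum_abs_hat_le hq _ _)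
    (fun i => {t | (c i : ℝ) ≤ G * t ∧ G * t ≤ c i + 1}) x hx
    (fun i m _ hm => mem_cell_of_hat_ne_zero hq hG (hx i) hm) F fun z hz i => ?_
  obtain ⟨R, hR, h⟩ := hF z hz i
  exact abs_sub_sum_hat_le hq hG (hc i) (φ := fun t => F (Function.update z i t)) hR h (hx i)

/-- The error estimate with E = 0. It requires polynomials only along lines parallel to the axes,
which is what `exists_polynomial_interp_update` supplies for a spline on a coarser grid. -/
lemma interp_eq_self (hq : 0 < q) (hG : 0 < G) {c : Fin l → ℤ}
    (hc : ∀ i, -(G : ℤ) ≤ c i ∧ c i < G) {F : (Fin l → ℝ) → ℝ}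
    (hF : ∀ z ∈ gridCell G c, ∀ i, ∃ R : Polynomial ℝ, R.natDegree ≤ q ∧
      ∀ t : ℝ, (c i : ℝ) ≤ G * t ∧ G * t ≤ c i + 1 → F (Function.update z i t) = R.eval t)
    {x : Fin l → ℝ} (hx : x ∈ gridCell G c) : interp q G F x = F x := by
  have := abs_sub_interp_le hq hG hc (F := F) le_rfl (fun z hz i => by
    obtain ⟨R, hR, h⟩ := hF z hz i
    exact ⟨R, hR, fun t ht => by rw [h t ht, sub_self, abs_zero]⟩) hx
  rw [mul_zero, mul_zero] at this
  exact (sub_eq_zero.1 (abs_nonpos_iff.1 this)).symm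

lemma exists_polynomial_interp_update (hq : 0 < q) {c : Fin l → ℤ} (F : (Fin l → ℝ) → ℝ)
    (z : Fin l → ℝ) (i : Fin l) : ∃ R : Polynomial ℝ, R.natDegree ≤ q ∧
      ∀ t : ℝ, (c i : ℝ) ≤ G * t ∧ G * t ≤ c i + 1 →
        interp q G F (Function.update z i t) = R.eval t := by
  refine ⟨∑ m ∈ Fintype.piFinset (fun _ : Fin l => Finset.Icc (-(q * G : ℤ)) (q * G)),
    Polynomial.C ((∏ j ∈ Finset.univ.erase i, hat q (m j) (q * G * z j)) * F (gridNode q G m)) *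
      (nodalBasis q (c i) (m i)).comp (Polynomial.C (q * G : ℝ) * Polynomial.X), ?_, ?_⟩
  · refine Polynomial.natDegree_sum_le_of_forall_le _ _ fun m _ => ?_
    refine (Polynomial.natDegree_C_mul_le _ _).trans 
      ((natDegree_comp_C_mul_X_le _ _).trans (natDegree_nodalBasis_le _ _ _))
  · intro t ht
    obtain ⟨h1, h2⟩ := cell_bounds_scaled (q := q) ht
    rw [interp, Polynomial.eval_finsetSum]
    refine Finset.sum_congr rfl fun m _ => ?_
    rw [← Finset.mul_prod_erase _ _ (Finset.mem_univ i), Function.update_self,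
      hat_eq hq (m i) h1 h2]
    have : ∏ j ∈ Finset.univ.erase i, hat q (m j) (q * G * Function.update z i t j) =
        ∏ j ∈ Finset.univ.erase i, hat q (m j) (q * G * z j) :=
      Finset.prod_congr rfl fun j hj => by
        rw [Function.update_of_ne (Finset.ne_of_mem_erase hj)]
    rw [this]
    simp only [Polynomial.eval_mul, Polynomial.eval_C, Polynomial.eval_comp, Polynomial.eval_X]
    ring

lemma degreeOf_aeval_X_le (i j : Fin l) (R : Polynomial ℝ) :
    (Polynomial.aeval (MvPolynomial.X i : MvPolynomial (Fin l) ℝ) R).degreeOf j ≤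
      if j = i then R.natDegree else 0 := by
  rw [Polynomial.aeval_eq_sum_range]
  refine (MvPolynomial.degreeOf_sum_le j _ _).trans (Finset.sup_le fun k hk => ?_)
  rw [MvPolynomial.smul_eq_C_mul]
  refine (MvPolynomial.degreeOf_C_mul_le _ _ _).trans
    ((MvPolynomial.degreeOf_pow_le _ _ _).trans ?_)
  rw [MvPolynomial.degreeOf_X]
  split_ifs with h
  · have := Finset.mem_range.1 hk; omega
  · simp

/-- On one cell every weight is a product of univariate polynomials in distinct variables, so the
degree in each variable comes from a single factor. -/
lemma exists_mvPolynomial_interp (hq : 0 < q) (c : Fin l → ℤ) (F : (Fin l → ℝ) → ℝ) :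
    ∃ P : MvPolynomial (Fin l) ℝ, (∀ i, P.degreeOf i ≤ q) ∧
      ∀ x ∈ gridCell G c, interp q G F x = MvPolynomial.eval x P := by
  refine ⟨∑ m ∈ Fintype.piFinset (fun _ : Fin l => Finset.Icc (-(q * G : ℤ)) (q * G)),
    MvPolynomial.C (F (gridNode q G m)) * ∏ i, Polynomial.aeval (MvPolynomial.X i)
      ((nodalBasis q (c i) (m i)).comp (Polynomial.C (q * G : ℝ) * Polynomial.X)), ?_, ?_⟩
  · intro j
    refine (MvPolynomial.degreeOf_sum_le j _ _).trans (Finset.sup_le fun m _ => ?_)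
    refine (MvPolynomial.degreeOf_C_mul_le _ _ _).trans
      ((MvPolynomial.degreeOf_prod_le _ _ _).trans ?_)
    refine (Finset.sum_le_sum fun i _ => degreeOf_aeval_X_le i j _).trans ?_
    rw [Finset.sum_ite_eq Finset.univ j, if_pos (Finset.mem_univ j)]
    exact (natDegree_comp_C_mul_X_le _ _).trans (natDegree_nodalBasis_le _ _ _)
  · intro x hx
    rw [interp, map_sum]
    refine Finset.sum_congr rfl fun m _ => ?_
    rw [map_mul, map_prod, MvPolynomial.eval_C, mul_comm]
    congr 1
    refine Finset.prod_congr rfl fun i _ => ?_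
    obtain ⟨h1, h2⟩ := cell_bounds_scaled (q := q) (hx i)
    have : ∀ R : Polynomial ℝ, MvPolynomial.eval x
        (Polynomial.aeval (MvPolynomial.X i : MvPolynomial (Fin l) ℝ) R) = R.eval (x i) := by
      intro R
      rw [Polynomial.aeval_eq_sum_range, map_sum, Polynomial.eval_eq_sum_range]
      exact Finset.sum_congr rfl fun k _ => by simp [MvPolynomial.smul_eq_C_mul]
    rw [this, hat_eq hq (m i) h1 h2]
    simp

end TensorInterpolation

/-! ### Approximation by polynomials on an interval through repeated integration. -/

section PolynomialApproximation

lemma exists_antiderivative_polynomial (N : ℕ) (Q : Polynomial ℝ) (hQ : Q.degree < N) (a y : ℝ) :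
    ∃ P : Polynomial ℝ, P.degree < (N + 1 : ℕ) ∧ P.derivative = Q ∧ P.eval a = y := by
  set P₀ : Polynomial ℝ := ∑ k ∈ Finset.range N,
    Polynomial.C (Q.coeff k / (k + 1)) * Polynomial.X ^ (k + 1) with hP₀
  have hdeg : P₀.degree < (N + 1 : ℕ) := by
    refine lt_of_le_of_lt (Polynomial.degree_sum_le _ _) ?_
    rw [Finset.sup_lt_iff (by exact_mod_cast WithBot.bot_lt_coe _)]
    intro k hk
    refine lt_of_le_of_lt (Polynomial.degree_C_mul_X_pow_le _ _) ?_
    exact_mod_cast Nat.succ_lt_succ (Finset.mem_range.1 hk)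
  have hder : P₀.derivative = Q := by
    rw [hP₀, Polynomial.derivative_sum]
    have hsum : Q = ∑ k ∈ Finset.range N, Polynomial.C (Q.coeff k) * Polynomial.X ^ k := by
      rcases Nat.eq_zero_or_pos N with h0 | h0
      · subst h0
        have : Q = 0 := by
          rw [← Polynomial.degree_eq_bot]; exact Nat.WithBot.lt_zero_iff.1 (by exact_mod_cast hQ)
        simp [this]
      · exact Polynomial.as_sum_range_C_mul_X_pow' Q (by
          rcases eq_or_ne Q 0 with rfl | hne
          · simpa using h0
          · exact (Polynomial.natDegree_lt_iff_degree_lt hne).2 hQ)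
    conv_rhs => rw [hsum]
    refine Finset.sum_congr rfl fun k _ => ?_
    have hk : ((k : ℝ) + 1) ≠ 0 := by positivity
    rw [Polynomial.derivative_C_mul_X_pow]
    push_cast
    rw [div_mul_cancel₀ _ hk]
  refine ⟨P₀ + Polynomial.C (y - P₀.eval a), ?_, ?_, ?_⟩
  · refine lt_of_le_of_lt (Polynomial.degree_add_le _ _) (max_lt hdeg ?_)
    exact lt_of_le_of_lt Polynomial.degree_C_le (by exact_mod_cast Nat.succ_pos N)
  · simp [hder]
  · simp

/-- If the `n`-th derivative of a function on `[a, b]` is close to a polynomial, then so is the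
function. -/
lemma exists_polynomial_approx {a b M : ℝ} (hab : a ≤ b) {m : ℕ} : ∀ (n : ℕ) (φ : ℕ → ℝ → ℝ)
    (_ : ∀ k < n, ∀ t ∈ Set.Icc a b, HasDerivWithinAt (φ k) (φ (k + 1) t) (Set.Icc a b) t)
    (Q : Polynomial ℝ) (_ : Q.degree < m) (_ : ∀ t ∈ Set.Icc a b, |φ n t - Q.eval t| ≤ M),
    ∃ R : Polynomial ℝ, R.degree < (m + n : ℕ) ∧
      ∀ t ∈ Set.Icc a b, |φ 0 t - R.eval t| ≤ (b - a) ^ n * M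
  | 0, φ, _, Q, hQ, hM => ⟨Q, hQ, fun t ht => by simpa using hM t ht⟩
  | n + 1, φ, hφ, Q, hQ, hM => by
      obtain ⟨R, hR, hRM⟩ := exists_polynomial_approx hab n (fun k => φ (k + 1))
        (fun k hk t ht => hφ (k + 1) (by omega) t ht) Q hQ hM
      -- The antiderivative is normalized to agree with `φ 0` at a, so the mean value inequality
      -- costs one factor b - a.
      obtain ⟨P, hP, hP', hPa⟩ := exists_antiderivative_polynomial _ R hR a (φ 0 a)
      refine ⟨P, hP, fun t ht => ?_⟩
      have hder : ∀ τ ∈ Set.Icc a b, HasDerivWithinAt (fun τ => φ 0 τ - P.eval τ)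
          (φ 1 τ - R.eval τ) (Set.Icc a b) τ := fun τ hτ => by
        have := (P.hasDerivAt τ).hasDerivWithinAt (s := Set.Icc a b)
        rw [hP'] at this
        exact (hφ 0 (by omega) τ hτ).sub this
      have := (convex_Icc a b).norm_image_sub_le_of_norm_hasDerivWithin_le hder
        (fun τ hτ => hRM τ hτ) (Set.left_mem_Icc.2 hab) ht
      simp only [hPa, sub_self, sub_zero, Real.norm_eq_abs] at this
      have hnn : 0 ≤ (b - a) ^ n * M := (abs_nonneg _).trans (hRM t ht)
      calc _ ≤ (b - a) ^ n * M * |t - a| := this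
        _ ≤ (b - a) ^ n * M * (b - a) := by
            refine mul_le_mul_of_nonneg_left ?_ hnn
            rw [abs_of_nonneg (by linarith [ht.1])]; linarith [ht.2]
        _ = _ := by ring

end PolynomialApproximation

/-! ### Regularity of the functions of the class, and their approximation along axis-parallel
segments. -/

section ClassQ

variable {l r u : ℕ} {γ : ℝ} {g : (Fin l → ℝ) → ℝ}

lemma mem_cube_iff {t : Fin l → ℝ} : t ∈ cube l ↔ ∀ i, |t i| ≤ 1 := by
  simp only [cube, Set.mem_Icc, Pi.le_def, Pi.neg_apply, Pi.one_apply, abs_le]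
  exact ⟨fun h i => ⟨h.1 i, h.2 i⟩, fun h => ⟨fun i => (h i).1, fun i => (h i).2⟩⟩

lemma mem_interior_cube_iff {t : Fin l → ℝ} : t ∈ interior (cube l) ↔ ∀ i, |t i| < 1 := by
  rw [cube, ← Set.pi_univ_Icc, interior_pi_set Set.finite_univ]
  simp [interior_Icc, abs_lt]

lemma frontier_cube : frontier (cube l) = cube l \ interior (cube l) :=
  isClosed_Icc.frontier_eq

lemma mem_cube_diff_frontier {t : Fin l → ℝ} (h : ∀ i, |t i| < 1) :
    t ∈ cube l \ frontier (cube l) :=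
  ⟨mem_cube_iff.2 fun i => (h i).le, fun h' => by
    rw [frontier_cube] at h'
    exact h'.2 (mem_interior_cube_iff.2 h)⟩

lemma mem_frontier_cube_of_eq_one {t : Fin l → ℝ} (h : t ∈ cube l) {i : Fin l} (hi : t i = 1) :
    t ∈ frontier (cube l) := by
  rw [frontier_cube]
  refine ⟨h, fun h' => ?_⟩
  have := mem_interior_cube_iff.1 h' i
  rw [hi, abs_one] at this
  exact lt_irrefl _ this

lemma update_mem_cube {t : Fin l → ℝ} (ht : t ∈ cube l) (i : Fin l) {τ : ℝ}
    (hτ : τ ∈ Set.Icc (-1 : ℝ) 1) : Function.update t i τ ∈ cube l := by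
  rw [mem_cube_iff] at ht ⊢
  intro j
  rcases eq_or_ne j i with rfl | hj
  · rw [Function.update_self]; exact abs_le.2 hτ
  · rw [Function.update_of_ne hj]; exact ht j

/-- A boundary point has some coordinate of modulus at least 1, and that coordinate alone accounts
for distance D. -/
lemma le_distBoundary (hl : 0 < l) {t : Fin l → ℝ} {D : ℝ} (h : ∀ i, |t i| ≤ 1 - D) :
    D ≤ distBoundary t := by
  refine (Metric.le_infDist ⟨1, ?_⟩).2 fun y hy => ?_
  · exact mem_frontier_cube_of_eq_one (mem_cube_iff.2 fun i => by simp) (i := ⟨0, hl⟩) rfl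
  · rw [frontier_cube] at hy
    have := hy.2
    rw [mem_interior_cube_iff] at this
    push Not at this
    obtain ⟨i, hi⟩ := this
    calc D ≤ |y i| - |t i| := by linarith [h i]
      _ ≤ |t i - y i| := by rw [abs_sub_comm]; exact abs_sub_abs_le_abs_sub _ _
      _ ≤ dist t y := dist_le_pi_dist t y i

lemma distBoundary_le_one (hl : 0 < l) {t : Fin l → ℝ} (ht : t ∈ cube l) : distBoundary t ≤ 1 := by
  set i : Fin l := ⟨0, hl⟩
  have hi := abs_le.1 (mem_cube_iff.1 ht i)
  rcases le_total 0 (t i) with h0 | h0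
  · have hy : Function.update t i 1 ∈ frontier (cube l) :=
      mem_frontier_cube_of_eq_one (update_mem_cube ht i (by simp)) (i := i) (by simp)
    refine (Metric.infDist_le_dist_of_mem hy).trans ((dist_pi_le_iff zero_le_one).2 fun j => ?_)
    rcases eq_or_ne j i with hj | hj
    · rw [hj, Function.update_self, Real.dist_eq, abs_le]; constructor <;> linarith
    · rw [Function.update_of_ne hj, dist_self]; exact zero_le_one
  · have hy : Function.update t i (-1) ∈ frontier (cube l) := by
      rw [frontier_cube]
      refine ⟨update_mem_cube ht i (by simp), fun h' => ?_⟩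
      have := mem_interior_cube_iff.1 h' i
      simp at this
    refine (Metric.infDist_le_dist_of_mem hy).trans ((dist_pi_le_iff zero_le_one).2 fun j => ?_)
    rcases eq_or_ne j i with hj | hj
    · rw [hj, Function.update_self, Real.dist_eq, abs_le]; constructor <;> linarith
    · rw [Function.update_of_ne hj, dist_self]; exact zero_le_one

/-- On (0, 1] both |log d| and d^(-κ) decrease, so the weight on a region is controlled by its
smallest distance to the boundary. -/
lemma weight_antitone {d D κ : ℝ} (u : ℕ) (hκ : 0 ≤ κ) (hD : 0 < D) (hd : D ≤ d) (hd1 : d ≤ 1) :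
    (1 + |Real.log d ^ u|) / d ^ κ ≤ (1 + |Real.log D| ^ u) / D ^ κ := by
  have hlog : |Real.log d| ≤ |Real.log D| := by
    rw [abs_of_nonpos (Real.log_nonpos (hD.le.trans hd) hd1),
      abs_of_nonpos (Real.log_nonpos hD.le (hd.trans hd1))]
    exact neg_le_neg (Real.log_le_log hD hd)
  rw [abs_pow]
  gcongr

/-- As log 2 < 1, the logarithm is at most m + 1 in modulus. The factor 2 absorbs the summand 1. -/
lemma weight_dyadic_le (u m : ℕ) (κ : ℝ) :
    (1 + |Real.log ((1 / 2 : ℝ) ^ m)| ^ u) / ((1 / 2 : ℝ) ^ m) ^ κ ≤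
      2 * (m + 1) ^ u * ((2 : ℝ) ^ κ) ^ m := by
  have h1 : |Real.log ((1 / 2 : ℝ) ^ m)| ≤ m + 1 := by
    rw [Real.log_pow, one_div, Real.log_inv, abs_mul, abs_neg, Nat.abs_cast,
      abs_of_pos (Real.log_pos one_lt_two)]
    have := Real.log_two_lt_d9
    have hm : (0 : ℝ) ≤ m := by positivity
    nlinarith
  have h2 : (1 : ℝ) ≤ (m + 1) ^ u := one_le_pow₀ (by linarith [(Nat.cast_nonneg m : (0 : ℝ) ≤ m)])
  have h3 : ((1 / 2 : ℝ) ^ m) ^ κ = (((2 : ℝ) ^ κ) ^ m)⁻¹ := by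
    rw [← Real.rpow_pow_comm (by norm_num), one_div, Real.inv_rpow (by norm_num), inv_pow]
  rw [h3, div_inv_eq_mul]
  refine mul_le_mul_of_nonneg_right ?_ (by positivity)
  have := pow_le_pow_left₀ (abs_nonneg _) h1 u
  linarith

lemma iterPartial_cons_update (L : List (Fin l)) (t : Fin l → ℝ) (i : Fin l) (τ : ℝ) :
    iterPartial g (i :: L) (Function.update t i τ) =
      derivWithin (fun τ => iterPartial g L (Function.update t i τ)) (Set.Icc (-1) 1) τ := by
  simp [iterPartial, cubePartial]

/-- At interior points the derivative relative to [-1, 1] is the ordinary one, so the assumed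
differentiability identifies the next iterated partial. -/
lemma IsInClassQ.hasDerivAt_iterPartial (h : IsInClassQ l r u γ g) {L : List (Fin l)}
    (hL : L.length < r + ⌈γ⌉₊) {t : Fin l → ℝ} {i : Fin l} {τ : ℝ}
    (ht : ∀ j, |Function.update t i τ j| < 1) :
    HasDerivAt (fun τ => iterPartial g L (Function.update t i τ))
      (iterPartial g (i :: L) (Function.update t i τ)) τ := by
  have hd := h.exists_partial L hL _ (mem_cube_diff_frontier ht) i
  simp only [Function.update_idem, Function.update_self] at hd
  have hτ : |τ| < 1 := by simpa using ht i
  rw [iterPartial_cons_update, derivWithin_of_mem_nhds (Icc_mem_nhds 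
    (abs_lt.1 hτ).1 (abs_lt.1 hτ).2)]
  exact hd.hasDerivAt

lemma IsInClassQ.abs_iterPartial_le (hl : 0 < l) (h : IsInClassQ l r u γ g) {L : List (Fin l)}
    (hL : r < L.length) (hL' : L.length ≤ r + ⌈γ⌉₊) (hζ : (⌈γ⌉₊ : ℝ) - γ ≤ 1) {D : ℝ} (hD : 0 < D)
    {t : Fin l → ℝ} (ht : ∀ i, |t i| ≤ 1 - D) :
    |iterPartial g L t| ≤
      (1 + |Real.log D| ^ u) / D ^ ((L.length : ℝ) - r - ((⌈γ⌉₊ : ℝ) - γ)) := by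
  have hint := mem_cube_diff_frontier (t := t) fun i => (ht i).trans_lt (by linarith)
  refine (h.bound_high L hL hL' t hint).trans (weight_antitone u ?_ hD (le_distBoundary hl ht)
    (distBoundary_le_one hl hint.1))
  have : (r + 1 : ℝ) ≤ L.length := by exact_mod_cast hL
  linarith

lemma uniqueDiffOn_cube : UniqueDiffOn ℝ (cube l) := by
  rw [cube, ← Set.pi_univ_Icc]
  exact UniqueDiffOn.univ_pi fun i => uniqueDiffOn_Icc (by simp)

lemma hasDerivWithinAt_comp_update {F : (Fin l → ℝ) → ℝ} (hF : DifferentiableOn ℝ F (cube l))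
    {t : Fin l → ℝ} (ht : t ∈ cube l) (i : Fin l) {τ : ℝ} (hτ : τ ∈ Set.Icc (-1 : ℝ) 1) :
    HasDerivWithinAt (fun τ => F (Function.update t i τ))
      (fderivWithin ℝ F (cube l) (Function.update t i τ) (Pi.single i 1)) (Set.Icc (-1) 1) τ :=
  ((hF _ (update_mem_cube ht i hτ)).hasFDerivWithinAt).comp_hasDerivWithinAt τ
    (hasDerivAt_update t i τ).hasDerivWithinAt (fun _ hσ => update_mem_cube ht i hσ)

lemma cubePartial_eq_fderivWithin {F : (Fin l → ℝ) → ℝ} (hF : DifferentiableOn ℝ F (cube l))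
    {t : Fin l → ℝ} (ht : t ∈ cube l) (i : Fin l) :
    cubePartial i F t = fderivWithin ℝ F (cube l) t (Pi.single i 1) := by
  have hti : t i ∈ Set.Icc (-1 : ℝ) 1 := abs_le.1 (mem_cube_iff.1 ht i)
  have := (hasDerivWithinAt_comp_update hF ht i hti).derivWithin
    (uniqueDiffOn_Icc (by norm_num) _ hti)
  rwa [Function.update_eq_self] at this

/-- Since the cube has unique derivatives, a partial derivative is the derivative within the cube
applied to a basis vector, and each one costs a single order of smoothness. -/
lemma contDiffOn_iterPartial : ∀ (L : List (Fin l)) (k : ℕ)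
    (_ : ContDiffOn ℝ (L.length + k : ℕ) g (cube l)),
    ContDiffOn ℝ k (iterPartial g L) (cube l)
  | [], k, h => by simpa [iterPartial] using h
  | i :: L, k, h => by
      have ih : ContDiffOn ℝ (k + 1 : ℕ) (iterPartial g L) (cube l) :=
        contDiffOn_iterPartial L (k + 1) (h.of_le (by
          simp only [List.length_cons]; exact_mod_cast (by omega)))
      have hd : DifferentiableOn ℝ (iterPartial g L) (cube l) :=
        ih.differentiableOn (by simp)
      have := (ih.fderivWithin uniqueDiffOn_cube (m := k) (by norm_cast)).clm_apply
        (contDiffOn_const (c := (Pi.single i 1 : Fin l → ℝ)))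
      exact this.congr fun t ht => cubePartial_eq_fderivWithin hd ht i

lemma IsInClassQ.hasDerivWithinAt_iterPartial (h : IsInClassQ l r u γ g) {L : List (Fin l)}
    (hL : L.length < r) {t : Fin l → ℝ} (ht : t ∈ cube l) (i : Fin l) {τ : ℝ}
    (hτ : τ ∈ Set.Icc (-1 : ℝ) 1) :
    HasDerivWithinAt (fun τ => iterPartial g L (Function.update t i τ))
      (iterPartial g (i :: L) (Function.update t i τ)) (Set.Icc (-1) 1) τ := by
  have hd : DifferentiableOn ℝ (iterPartial g L) (cube l) :=
    (contDiffOn_iterPartial L 1 (h.contDiffOn.of_le (by exact_mod_cast hL))).differentiableOn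
      (by simp)
  have h1 := hasDerivWithinAt_comp_update hd ht i hτ
  rwa [← cubePartial_eq_fderivWithin hd (update_mem_cube ht i hτ) i] at h1

/-- A function with bounded partial derivatives is Lipschitz. -/
lemma abs_sub_le_of_partial_le {G : (Fin l → ℝ) → ℝ} {G' : Fin l → (Fin l → ℝ) → ℝ} {D M η : ℝ}
    (hG : ∀ i t, (∀ j, |t j| ≤ 1 - D) → ∀ τ, |τ| ≤ 1 - D →
      HasDerivAt (fun τ => G (Function.update t i τ)) (G' i (Function.update t i τ)) τ)
    (hM : ∀ i t, (∀ j, |t j| ≤ 1 - D) → |G' i t| ≤ M) {x y : Fin l → ℝ}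
    (hx : ∀ j, |x j| ≤ 1 - D) (hy : ∀ j, |y j| ≤ 1 - D) (hη : ∀ j, |x j - y j| ≤ η)
    (hM0 : 0 ≤ M) : |G x - G y| ≤ l * (M * η) := by
  -- Pass from y to x one coordinate at a time; A is the set of coordinates already replaced.
  have key : ∀ A : Finset (Fin l), |G (A.piecewise x y) - G y| ≤ A.card * (M * η) := by
    intro A
    induction A using Finset.induction_on with
    | empty => simp
    | insert j A hj ih =>
      have hz : ∀ k, |A.piecewise x y k| ≤ 1 - D := fun k => by
        by_cases hk : k ∈ A
        · rw [Finset.piecewise_eq_of_mem _ _ _ hk]; exact hx k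
        · rw [Finset.piecewise_eq_of_notMem _ _ _ hk]; exact hy k
      have hzj : A.piecewise x y j = y j := Finset.piecewise_eq_of_notMem _ _ _ hj
      have hup : ∀ τ, |τ| ≤ 1 - D → ∀ k, |Function.update (A.piecewise x y) j τ k| ≤ 1 - D := by
        intro τ hτ k
        rcases eq_or_ne k j with rfl | hk
        · rwa [Function.update_self]
        · rw [Function.update_of_ne hk]; exact hz k
      have hstep := (convex_Icc (-(1 - D)) (1 - D)).norm_image_sub_le_of_norm_hasDerivWithin_le
        (f := fun τ => G (Function.update (A.piecewise x y) j τ))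
        (fun τ hτ => (hG j _ hz τ (abs_le.2 hτ)).hasDerivWithinAt)
        (fun τ hτ => hM j _ (hup τ (abs_le.2 hτ))) (abs_le.1 (hy j)) (abs_le.1 (hx j))
      simp only [Real.norm_eq_abs] at hstep
      rw [← hzj, Function.update_eq_self, hzj, ← Finset.piecewise_insert] at hstep
      rw [Finset.card_insert_of_notMem hj]
      push_cast
      have h3 : M * |x j - y j| ≤ M * η := mul_le_mul_of_nonneg_left (hη j) hM0
      have := abs_sub_le (G ((insert j A).piecewise x y)) (G (A.piecewise x y)) (G y)
      linarith
  have := key Finset.univ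
  rwa [Finset.piecewise_univ, Finset.card_univ, Fintype.card_fin] at this

/-- In the interior, the derivatives of order `r` of functions of the class are Lipschitz at dyadic
distance from the boundary. -/
lemma IsInClassQ.abs_iterPartial_sub_le (hl : 0 < l) (h : IsInClassQ l r u γ g)
    (hγ : 0 < γ) (hζ : (⌈γ⌉₊ : ℝ) - γ ≤ 1) {L : List (Fin l)} (hL : L.length = r) (m : ℕ) {η : ℝ}
    {x y : Fin l → ℝ} (hx : ∀ j, |x j| ≤ 1 - (1 / 2) ^ m) (hy : ∀ j, |y j| ≤ 1 - (1 / 2) ^ m)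
    (hη : ∀ j, |x j - y j| ≤ (1 / 2) ^ m * η) :
    |iterPartial g L x - iterPartial g L y| ≤
      l * η * (2 * (m + 1) ^ u * ((1 / 2 : ℝ) ^ ((⌈γ⌉₊ : ℝ) - γ)) ^ m) := by
  have hceil : 0 < ⌈γ⌉₊ := Nat.ceil_pos.2 hγ
  have hD : (0 : ℝ) < (1 / 2) ^ m := by positivity
  have hup : ∀ (i : Fin l) (t : Fin l → ℝ), (∀ j, |t j| ≤ 1 - (1 / 2 : ℝ) ^ m) →
      ∀ τ, |τ| ≤ 1 - (1 / 2 : ℝ) ^ m → ∀ j, |Function.update t i τ j| < 1 := by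
    intro i t ht τ hτ j
    rcases eq_or_ne j i with rfl | hj
    · rw [Function.update_self]; linarith
    · rw [Function.update_of_ne hj]; linarith [ht j]
  have hexp : ((r + 1 : ℕ) : ℝ) - r - ((⌈γ⌉₊ : ℝ) - γ) = 1 - ((⌈γ⌉₊ : ℝ) - γ) := by push_cast; ring
  have := abs_sub_le_of_partial_le (G := iterPartial g L) (G' := fun i => iterPartial g (i :: L))
    (M := 2 * (m + 1) ^ u * ((2 : ℝ) ^ (1 - ((⌈γ⌉₊ : ℝ) - γ))) ^ m)
    (fun i t ht τ hτ => h.hasDerivAt_iterPartial (by omega) (hup i t ht τ hτ))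
    (fun i t ht => by
      have hb := h.abs_iterPartial_le hl (L := i :: L) (by simp [hL])
        (by simp only [List.length_cons, hL]; omega) hζ hD ht
      rw [List.length_cons, hL, hexp] at hb
      exact hb.trans (weight_dyadic_le u m _)) hx hy hη (by positivity)
  refine this.trans (le_of_eq ?_)
  -- The derivative grows like 2^((1-ζ)m) and the step has length of order 2^-m, which leaves the
  -- decaying factor 2^(-ζm).
  have h2 : (2 : ℝ) ^ (1 - ((⌈γ⌉₊ : ℝ) - γ)) = 2 * (1 / 2) ^ ((⌈γ⌉₊ : ℝ) - γ) := by
    rw [Real.rpow_sub (by norm_num), Real.rpow_one, one_div, Real.inv_rpow (by norm_num)]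
    rfl
  rw [h2, mul_pow]
  have h3 : (2 : ℝ) ^ m * (1 / 2) ^ m = 1 := by rw [← mul_pow]; norm_num
  linear_combination (l * (2 * (m + 1) ^ u * ((1 / 2 : ℝ) ^ ((⌈γ⌉₊ : ℝ) - γ)) ^ m) * η) * h3

/-- The constant in the modulus of continuity of the derivatives of order `r`. -/
def oscConst (l u : ℕ) (b : ℝ) : ℝ := 4 * l * (∑' j : ℕ, ((j : ℝ) + 2) ^ u * b ^ j) + 2 * l

lemma summable_pow_mul_geometric {b : ℝ} (hb0 : 0 < b) (hb1 : b < 1) (u : ℕ) :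
    Summable fun j : ℕ => ((j : ℝ) + 2) ^ u * b ^ j := by
  have h := (summable_pow_mul_geometric_of_norm_lt_one (R := ℝ) u (r := b)
    (by rwa [Real.norm_eq_abs, abs_of_pos hb0])).comp_injective (add_left_injective 2)
  refine (h.mul_left (b ^ 2)⁻¹).congr fun j => ?_
  simp only [Function.comp_apply]
  push_cast
  field_simp
  ring

lemma abs_dilation_le {x : Fin l → ℝ} (hx : x ∈ cube l) {m n : ℕ} (hmn : m ≤ n) (j : Fin l) :
    |((1 - (1 / 2 : ℝ) ^ m) • x) j| ≤ 1 - (1 / 2) ^ n := by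
  have h1 : (1 / 2 : ℝ) ^ n ≤ (1 / 2) ^ m := pow_le_pow_of_le_one (by norm_num) (by norm_num) hmn
  have h2 : (1 / 2 : ℝ) ^ m ≤ 1 := pow_le_one₀ (by norm_num) (by norm_num)
  have hx := mem_cube_iff.1 hx j
  rw [Pi.smul_apply, smul_eq_mul, abs_mul, abs_of_nonneg (by linarith)]
  nlinarith [abs_nonneg (x j)]

/-- The derivatives of order `r` of functions of the class along the dilations `(1 - 2⁻ᵐ) x` of a
point of the cube. -/
lemma IsInClassQ.abs_iterPartial_dilation_sub_le (hl : 0 < l) (h : IsInClassQ l r u γ g)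
    (hγ : 0 < γ) (hζ : (⌈γ⌉₊ : ℝ) - γ ≤ 1) (hζ0 : 0 < (⌈γ⌉₊ : ℝ) - γ) {L : List (Fin l)}
    (hL : L.length = r) {x : Fin l → ℝ} (hx : x ∈ cube l) (K : ℕ) :
    |iterPartial g L x - iterPartial g L ((1 - (1 / 2 : ℝ) ^ K) • x)| ≤
      2 * l * (∑' j : ℕ, ((j : ℝ) + 2) ^ u * ((1 / 2 : ℝ) ^ ((⌈γ⌉₊ : ℝ) - γ)) ^ j) *
        ((K + 1) ^ u * ((1 / 2 : ℝ) ^ ((⌈γ⌉₊ : ℝ) - γ)) ^ K) := by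
  set b : ℝ := (1 / 2 : ℝ) ^ ((⌈γ⌉₊ : ℝ) - γ) with hb
  have hb0 : 0 < b := by positivity
  have hb1 : b < 1 := Real.rpow_lt_one (by norm_num) (by norm_num) hζ0
  set G := iterPartial g L
  have hsum := summable_pow_mul_geometric hb0 hb1 u
  -- Consecutive dilations differ by at most 2^-(m+1) per coordinate, and both lie where the
  -- distance to the boundary is at least 2^-(m+1). These increments are summed and continuity up to
  -- the boundary gives the value at x.
  have hstep : ∀ m : ℕ, |G ((1 - (1 / 2 : ℝ) ^ (m + 1)) • x) - G ((1 - (1 / 2 : ℝ) ^ m) • x)| ≤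
      l * (2 * ((m : ℝ) + 2) ^ u * b ^ (m + 1)) := by
    intro m
    have := h.abs_iterPartial_sub_le hl hγ hζ hL (m + 1) (η := 1)
      (abs_dilation_le hx le_rfl) (abs_dilation_le hx (Nat.le_succ m)) (fun j => by
        have hx := mem_cube_iff.1 hx j
        simp only [Pi.smul_apply, smul_eq_mul]
        rw [← sub_mul, abs_mul, mul_one]
        have : (1 - (1 / 2 : ℝ) ^ (m + 1) - (1 - (1 / 2) ^ m)) = (1 / 2) ^ (m + 1) := by ring
        rw [this, abs_of_nonneg (by positivity)]
        have hp : (0 : ℝ) < (1 / 2) ^ (m + 1) := by positivity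
        nlinarith)
    refine this.trans (le_of_eq ?_)
    push_cast
    ring
  have hpart : ∀ J : ℕ, |G ((1 - (1 / 2 : ℝ) ^ (K + J)) • x) - G ((1 - (1 / 2 : ℝ) ^ K) • x)| ≤
      2 * l * ((K + 1) ^ u * b ^ K) * ∑ j ∈ Finset.range J, ((j : ℝ) + 2) ^ u * b ^ j := by
    intro J
    induction J with
    | zero => simp
    | succ J ih =>
      rw [Finset.sum_range_succ, mul_add]
      have h1 := hstep (K + J)
      -- This separates K from the summation index and leaves a convergent series independent of K.
      have h2 : ((K + J : ℕ) + 2 : ℝ) ^ u ≤ (K + 1) ^ u * ((J : ℝ) + 2) ^ u := by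
        rw [← mul_pow]
        push_cast
        have hK : (0 : ℝ) ≤ K := by positivity
        have hJ : (0 : ℝ) ≤ J := by positivity
        exact pow_le_pow_left₀ (by positivity) (by nlinarith) u
      have h3 : (l : ℝ) * (2 * ((K + J : ℕ) + 2 : ℝ) ^ u * b ^ (K + J + 1)) ≤
          2 * l * ((K + 1) ^ u * b ^ K) * (((J : ℝ) + 2) ^ u * b ^ J) := by
        have hpw : b ^ (K + J + 1) ≤ b ^ K * b ^ J := by
          rw [pow_succ, pow_add]
          exact mul_le_of_le_one_right (by positivity) hb1.le
        calc _ ≤ (l : ℝ) * (2 * ((K + 1) ^ u * ((J : ℝ) + 2) ^ u) * (b ^ K * b ^ J)) := by gcongr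
          _ = _ := by ring
      have := abs_sub_le (G ((1 - (1 / 2 : ℝ) ^ (K + (J + 1))) • x))
        (G ((1 - (1 / 2 : ℝ) ^ (K + J)) • x)) (G ((1 - (1 / 2 : ℝ) ^ K) • x))
      rw [← add_assoc] at this ⊢
      linarith
  have hcont : ContinuousOn G (cube l) :=
    (contDiffOn_iterPartial L 0 (by rw [add_zero, hL]; exact h.contDiffOn)).continuousOn
  have hlim : Filter.Tendsto (fun J : ℕ => (1 - (1 / 2 : ℝ) ^ (K + J)) • x) Filter.atTop
      (nhds x) := by
    have h0 : Filter.Tendsto (fun J : ℕ => (1 / 2 : ℝ) ^ (K + J)) Filter.atTop (nhds 0) :=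
      (tendsto_pow_atTop_nhds_zero_of_lt_one (by norm_num) (by norm_num)).comp
        (Filter.tendsto_atTop_mono (fun J => Nat.le_add_left J K) Filter.tendsto_id)
    have := (h0.const_sub 1).smul_const x
    simpa using this
  have hlimG : Filter.Tendsto (fun J : ℕ => G ((1 - (1 / 2 : ℝ) ^ (K + J)) • x)) Filter.atTop
      (nhds (G x)) := by
    refine (hcont x hx).tendsto.comp (tendsto_nhdsWithin_iff.2 ⟨hlim, Filter.Eventually.of_forall
      fun J => mem_cube_iff.2 fun j => (abs_dilation_le hx le_rfl j).trans ?_⟩)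
    have : (0 : ℝ) < (1 / 2) ^ (K + J) := by positivity
    linarith
  refine le_of_tendsto ((hlimG.sub_const _).abs) (Filter.Eventually.of_forall fun J => ?_)
  refine (hpart J).trans ?_
  have := hsum.sum_le_tsum (Finset.range J) (fun j _ => by positivity)
  calc _ ≤ 2 * l * ((K + 1) ^ u * b ^ K) * ∑' j : ℕ, ((j : ℝ) + 2) ^ u * b ^ j := by gcongr
    _ = _ := by ring

/-- Go from x to its dilation, across to the dilation of y at distance at least 2^-K from the
boundary, and back to y. The outer steps give the two series in `oscConst`, the middle one its
summand 2l. -/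
lemma IsInClassQ.abs_iterPartial_sub_le_of_close (hl : 0 < l) (h : IsInClassQ l r u γ g)
    (hγ : 0 < γ) (hζ : (⌈γ⌉₊ : ℝ) - γ ≤ 1) (hζ0 : 0 < (⌈γ⌉₊ : ℝ) - γ) {L : List (Fin l)}
    (hL : L.length = r) {x y : Fin l → ℝ} (hx : x ∈ cube l) (hy : y ∈ cube l) {K : ℕ}
    (hxy : ∀ j, |x j - y j| ≤ (1 / 2) ^ K) :
    |iterPartial g L x - iterPartial g L y| ≤
      oscConst l u ((1 / 2 : ℝ) ^ ((⌈γ⌉₊ : ℝ) - γ)) *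
        ((K + 1) ^ u * ((1 / 2 : ℝ) ^ ((⌈γ⌉₊ : ℝ) - γ)) ^ K) := by
  have h1 := h.abs_iterPartial_dilation_sub_le hl hγ hζ hζ0 hL hx K
  have h2 := h.abs_iterPartial_dilation_sub_le hl hγ hζ hζ0 hL hy K
  have h3 := h.abs_iterPartial_sub_le hl hγ hζ hL K (η := 1) (abs_dilation_le hx le_rfl)
    (abs_dilation_le hy le_rfl) (fun j => by
      simp only [Pi.smul_apply, smul_eq_mul]
      have hp : (1 / 2 : ℝ) ^ K ≤ 1 := pow_le_one₀ (by norm_num) (by norm_num)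
      have hp0 : (0 : ℝ) < (1 / 2) ^ K := by positivity
      rw [← mul_sub, abs_mul, abs_of_nonneg (by linarith), mul_one]
      nlinarith [hxy j, abs_nonneg (x j - y j)])
  have h4 := abs_sub_le (iterPartial g L x) (iterPartial g L ((1 - (1 / 2 : ℝ) ^ K) • x))
    (iterPartial g L y)
  have h5 := abs_sub_le (iterPartial g L ((1 - (1 / 2 : ℝ) ^ K) • x))
    (iterPartial g L ((1 - (1 / 2 : ℝ) ^ K) • y)) (iterPartial g L y)
  rw [abs_sub_comm (iterPartial g L ((1 - (1 / 2 : ℝ) ^ K) • y))] at h5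
  unfold oscConst
  linarith

/-- Approximation by polynomials along segments in the interior of the cube. -/
lemma IsInClassQ.exists_polynomial_interior (hl : 0 < l) (h : IsInClassQ l r u γ g)
    (hγ : 0 < γ) (hζ : (⌈γ⌉₊ : ℝ) - γ ≤ 1) {m : ℕ} {z : Fin l → ℝ}
    (hz : ∀ j, |z j| ≤ 1 - (1 / 2) ^ m) (i : Fin l) {a b : ℝ} (hab : a ≤ b)
    (ha : -(1 - (1 / 2) ^ m) ≤ a) (hb : b ≤ 1 - (1 / 2) ^ m) :
    ∃ R : Polynomial ℝ, R.natDegree ≤ r + ⌈γ⌉₊ - 1 ∧ ∀ t ∈ Set.Icc a b,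
      |g (Function.update z i t) - R.eval t| ≤
        (b - a) ^ (r + ⌈γ⌉₊) * (2 * (m + 1) ^ u * ((2 : ℝ) ^ γ) ^ m) := by
  have hceil : 0 < ⌈γ⌉₊ := Nat.ceil_pos.2 hγ
  have hD : (0 : ℝ) < (1 / 2) ^ m := by positivity
  have hup : ∀ τ ∈ Set.Icc a b, ∀ j, |Function.update z i τ j| ≤ 1 - (1 / 2 : ℝ) ^ m := by
    intro τ hτ j
    rcases eq_or_ne j i with rfl | hj
    · rw [Function.update_self, abs_le]; constructor <;> linarith [hτ.1, hτ.2]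
    · rw [Function.update_of_ne hj]; exact hz j
  -- The derivative of order s is compared with the zero polynomial; the weight exponent s - r - ζ
  -- is γ.
  obtain ⟨R, hR, hRM⟩ := exists_polynomial_approx hab (m := 0) (r + ⌈γ⌉₊)
    (fun k t => iterPartial g (List.replicate k i) (Function.update z i t))
    (fun k hk t ht => by
      rw [List.replicate_succ]
      exact (h.hasDerivAt_iterPartial (by simpa using hk)
        fun j => (hup t ht j).trans_lt (by linarith)).hasDerivWithinAt) 0
    (by rw [Polynomial.degree_zero]; exact WithBot.bot_lt_coe _)
    (M := 2 * (m + 1) ^ u * ((2 : ℝ) ^ γ) ^ m) (fun t ht => by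
      rw [Polynomial.eval_zero, sub_zero]
      have := h.abs_iterPartial_le hl (L := List.replicate (r + ⌈γ⌉₊) i)
        (by simp [hceil]) (by simp) hζ hD (hup t ht)
      rw [List.length_replicate,
        show ((r + ⌈γ⌉₊ : ℕ) : ℝ) - r - ((⌈γ⌉₊ : ℝ) - γ) = γ by push_cast; ring] at this
      exact this.trans (weight_dyadic_le u m γ))
  refine ⟨R, ?_, fun t ht => by simpa [iterPartial] using hRM t ht⟩
  rw [zero_add] at hR
  have : R.natDegree < r + ⌈γ⌉₊ := by
    rcases eq_or_ne R 0 with rfl | hne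
    · rw [Polynomial.natDegree_zero]; omega
    · exact (Polynomial.natDegree_lt_iff_degree_lt hne).2 hR
  omega

/-- Approximation by polynomials along arbitrary segments in the cube. -/
lemma IsInClassQ.exists_polynomial_closed (hl : 0 < l) (h : IsInClassQ l r u γ g)
    (hγ : 0 < γ) (hζ : (⌈γ⌉₊ : ℝ) - γ ≤ 1) (hζ0 : 0 < (⌈γ⌉₊ : ℝ) - γ) {K : ℕ} {z : Fin l → ℝ}
    (hz : z ∈ cube l) (i : Fin l) {a b : ℝ} (hab : a ≤ b) (ha : -1 ≤ a) (hb : b ≤ 1)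
    (hK : b - a ≤ (1 / 2) ^ K) :
    ∃ R : Polynomial ℝ, R.natDegree ≤ r + ⌈γ⌉₊ - 1 ∧ ∀ t ∈ Set.Icc a b,
      |g (Function.update z i t) - R.eval t| ≤
        (b - a) ^ r * (oscConst l u ((1 / 2 : ℝ) ^ ((⌈γ⌉₊ : ℝ) - γ)) *
          ((K + 1) ^ u * ((1 / 2 : ℝ) ^ ((⌈γ⌉₊ : ℝ) - γ)) ^ K)) := by
  have hceil : 0 < ⌈γ⌉₊ := Nat.ceil_pos.2 hγ
  have hsub : Set.Icc a b ⊆ Set.Icc (-1) 1 := Set.Icc_subset_Icc ha hb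
  -- Up to the boundary only r derivatives are available; the last one is compared with its value at
  -- the left endpoint, giving degree at most r ≤ s - 1.
  obtain ⟨R, hR, hRM⟩ := exists_polynomial_approx hab (m := 1) r
    (fun k t => iterPartial g (List.replicate k i) (Function.update z i t))
    (fun k hk t ht => by
      rw [List.replicate_succ]
      exact (h.hasDerivWithinAt_iterPartial (by simpa using hk) hz i (hsub ht)).mono hsub)
    (Polynomial.C (iterPartial g (List.replicate r i) (Function.update z i a)))
    (lt_of_le_of_lt Polynomial.degree_C_le (by exact_mod_cast zero_lt_one)) (fun t ht => by
      rw [Polynomial.eval_C]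
      refine h.abs_iterPartial_sub_le_of_close (K := K) hl hγ hζ hζ0 (by simp)
        (update_mem_cube hz i (hsub ht)) (update_mem_cube hz i (hsub (Set.left_mem_Icc.2 hab)))
        fun j => ?_
      rcases eq_or_ne j i with rfl | hj
      · rw [Function.update_self, Function.update_self, abs_of_nonneg (by linarith [ht.1])]
        linarith [ht.2]
      · rw [Function.update_of_ne hj, Function.update_of_ne hj, sub_self, abs_zero]
        positivity)
  refine ⟨R, ?_, fun t ht => by simpa [iterPartial] using hRM t ht⟩
  have : R.natDegree < 1 + r := by
    rcases eq_or_ne R 0 with rfl | hne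
    · rw [Polynomial.natDegree_zero]; omega
    · exact (Polynomial.natDegree_lt_iff_degree_lt hne).2 hR
  omega

end ClassQ

/-! ### The graded spline on dyadic shells: consistency, locality and stability. -/

section GradedSpline

variable {l q K : ℕ} {p : ℕ → ℕ}

/-- The radius, in cells, of the cube which the shell of index `k` surrounds. -/
def innerRadius (p : ℕ → ℕ) (k : ℕ) : ℤ := 2 ^ p k - 2 ^ (p k - k)

/-- The radius, in cells, of the union of the shells of index at most `k`. -/
def outerRadius (p : ℕ → ℕ) (K k : ℕ) : ℤ :=
  if k < K then 2 ^ p k - 2 ^ (p k - (k + 1)) else 2 ^ p k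

lemma cast_dyadic_radius {n k : ℕ} (h : k ≤ n) :
    ((2 ^ n - 2 ^ (n - k) : ℤ) : ℝ) = 2 ^ n * (1 - (1 / 2) ^ k) := by
  have : (2 : ℝ) ^ n = 2 ^ (n - k) * 2 ^ k := by rw [← pow_add, Nat.sub_add_cancel h]
  push_cast
  rw [mul_sub, mul_one, this, mul_assoc, ← mul_pow]
  norm_num

lemma cast_innerRadius {k : ℕ} (h : k + 2 ≤ p k) :
    (innerRadius p k : ℝ) = 2 ^ p k * (1 - (1 / 2) ^ k) := cast_dyadic_radius (by omega)

/-- The radius of the union of the shells of index at most `k`. -/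
def shellRadius (K k : ℕ) : ℝ := if k < K then 1 - (1 / 2) ^ (k + 1) else 1

lemma cast_outerRadius {k : ℕ} (h : k + 2 ≤ p k) :
    (outerRadius p K k : ℝ) = 2 ^ p k * shellRadius K k := by
  unfold outerRadius shellRadius
  split_ifs
  · exact cast_dyadic_radius (by omega)
  · push_cast; ring

lemma shellRadius_le_one (k : ℕ) : shellRadius K k ≤ 1 := by
  unfold shellRadius
  split_ifs
  · have : (0 : ℝ) < (1 / 2) ^ (k + 1) := by positivity
    linarith
  · exact le_rfl

lemma abs_le_iff_scaled {n : ℕ} {A : ℤ} {ρ t : ℝ} (hA : (A : ℝ) = 2 ^ n * ρ) :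
    |t| ≤ ρ ↔ |((2 ^ n : ℕ) : ℝ) * t| ≤ A := by
  have h2 : (0 : ℝ) < 2 ^ n := by positivity
  push_cast
  rw [hA, abs_mul, abs_of_pos h2, mul_le_mul_iff_right₀ h2]

lemma abs_le_of_mem_cell {A c : ℤ} (hc : c ∈ Finset.Ico (-A) A) {y : ℝ}
    (h : (c : ℝ) ≤ y ∧ y ≤ c + 1) :
    |y| ≤ A := by
  rw [Finset.mem_Ico] at hc
  have h1 : (-A : ℝ) ≤ c := by exact_mod_cast hc.1
  have h2 : (c + 1 : ℝ) ≤ A := by exact_mod_cast hc.2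
  rw [abs_le]
  constructor <;> linarith

lemma le_abs_of_mem_cell {A c : ℤ} (hc : c ∉ Finset.Ico (-A) A) {y : ℝ}
    (h : (c : ℝ) ≤ y ∧ y ≤ c + 1) : (A : ℝ) ≤ |y| := by
  rw [Finset.mem_Ico, not_and_or, not_le, not_lt] at hc
  rcases hc with hc | hc
  · have h1 : (c + 1 : ℝ) ≤ -A := by exact_mod_cast hc
    exact le_trans (by linarith [h.2]) (neg_le_abs y)
  · have h1 : (A : ℝ) ≤ c := by exact_mod_cast hc
    exact le_trans (by linarith [h.1]) (le_abs_self y)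

lemma exists_cell_of_abs_le {A : ℤ} (hA : 0 < A) {y : ℝ} (h : |y| ≤ A) :
    ∃ c ∈ Finset.Ico (-A) A, (c : ℝ) ≤ y ∧ y ≤ c + 1 := by
  rw [abs_le] at h
  rcases h.2.lt_or_eq with h2 | h2
  · refine ⟨⌊y⌋, Finset.mem_Ico.2 ⟨?_, ?_⟩, Int.floor_le y, (Int.lt_floor_add_one y).le⟩
    · rw [Int.le_floor]; push_cast; exact h.1
    · rwa [Int.floor_lt]
  · refine ⟨A - 1, Finset.mem_Ico.2 ⟨by omega, by omega⟩, ?_, ?_⟩ <;> push_cast <;> linarith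

/-- The cells of the shell of index `k`. -/
def shellCells (l : ℕ) (p : ℕ → ℕ) (K k : ℕ) : Finset (Fin l → ℤ) :=
  Fintype.piFinset (fun _ => Finset.Ico (-outerRadius p K k) (outerRadius p K k)) \
    Fintype.piFinset (fun _ => Finset.Ico (-innerRadius p k) (innerRadius p k))

lemma mem_shellCells {k : ℕ} {c : Fin l → ℤ} : c ∈ shellCells l p K k ↔
    (∀ i, c i ∈ Finset.Ico (-outerRadius p K k) (outerRadius p K k)) ∧
      ∃ i, c i ∉ Finset.Ico (-innerRadius p k) (innerRadius p k) := by
  simp only [shellCells, Finset.mem_sdiff, Fintype.mem_piFinset, not_forall]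

lemma outerRadius_le {k : ℕ} : outerRadius p K k ≤ 2 ^ p k := by
  unfold outerRadius
  split_ifs
  · have : (0 : ℤ) < 2 ^ (p k - (k + 1)) := by positivity
    omega
  · exact le_rfl

lemma outerRadius_pos {k : ℕ} (h : k + 2 ≤ p k) : 0 < outerRadius p K k := by
  unfold outerRadius
  split_ifs
  · have : (2 : ℤ) ^ (p k - (k + 1)) < 2 ^ p k := pow_lt_pow_right₀ (by norm_num) (by omega)
    omega
  · positivity

lemma innerRadius_pos {k : ℕ} (h : k + 3 ≤ p (k + 1)) : 0 < innerRadius p (k + 1) := by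
  unfold innerRadius
  have : (2 : ℤ) ^ (p (k + 1) - (k + 1)) < 2 ^ p (k + 1) :=
    pow_lt_pow_right₀ (by norm_num) (by omega)
  omega

lemma admissible_of_mem_shellCells {k : ℕ} {c : Fin l → ℤ} (hc : c ∈ shellCells l p K k) (i : Fin l) :
    -((2 ^ p k : ℕ) : ℤ) ≤ c i ∧ c i < (2 ^ p k : ℕ) := by
  have h1 := Finset.mem_Ico.1 ((mem_shellCells.1 hc).1 i)
  have h2 : outerRadius p K k ≤ 2 ^ p k := outerRadius_le
  push_cast
  constructor <;> omega

lemma abs_le_shellRadius {k : ℕ} (hk : k + 2 ≤ p k) {c : Fin l → ℤ} (hc : c ∈ shellCells l p K k)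
    {x : Fin l → ℝ} (hx : x ∈ gridCell (2 ^ p k) c) (i : Fin l) : |x i| ≤ shellRadius K k := by
  rw [abs_le_iff_scaled (cast_outerRadius hk)]
  exact abs_le_of_mem_cell ((mem_shellCells.1 hc).1 i) (hx i)

lemma mem_cube_of_mem_shell {k : ℕ} (hk : k + 2 ≤ p k) {c : Fin l → ℤ} (hc : c ∈ shellCells l p K k)
    {x : Fin l → ℝ} (hx : x ∈ gridCell (2 ^ p k) c) : x ∈ cube l :=
  mem_cube_iff.2 fun i => (abs_le_shellRadius hk hc hx i).trans (shellRadius_le_one k)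

open Classical in
/-- Continuous piecewise polynomial interpolation on a graded grid: on each grid, the nodal values in
the region of the coarser grids are those of the spline on the coarser grids. -/
def gradedSpline (q : ℕ) (p : ℕ → ℕ) : ℕ → ((Fin l → ℝ) → ℝ) → (Fin l → ℝ) → ℝ
  | 0, F => interp q (2 ^ p 0) F
  | k + 1, F => interp q (2 ^ p (k + 1)) fun x =>
      if ∀ i, |x i| ≤ 1 - (1 / 2) ^ (k + 1) then gradedSpline q p k F x else F x

lemma exists_gradedSpline_eq_interp (k : ℕ) (F : (Fin l → ℝ) → ℝ) :
    ∃ F' : (Fin l → ℝ) → ℝ, gradedSpline q p k F = interp q (2 ^ p k) F' := by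
  cases k <;> exact ⟨_, rfl⟩

lemma continuous_gradedSpline (hq : 0 < q) (k : ℕ) (F : (Fin l → ℝ) → ℝ) :
    Continuous (gradedSpline q p k F) := by
  obtain ⟨F', hF'⟩ := exists_gradedSpline_eq_interp (q := q) (p := p) k F
  rw [hF']
  exact continuous_interp hq F'

lemma gradedSpline_add (k : ℕ) (F F' : (Fin l → ℝ) → ℝ) :
    gradedSpline q p k (F + F') = gradedSpline q p k F + gradedSpline q p k F' := by
  induction k with
  | zero => funext x; exact interp_add F F' x
  | succ k ih =>
    funext x
    rw [Pi.add_apply]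
    simp only [gradedSpline]
    rw [← interp_add]
    congr 1
    funext y
    rw [ih]
    simp only [Pi.add_apply]
    split_ifs <;> rfl

lemma gradedSpline_smul (k : ℕ) (a : ℝ) (F : (Fin l → ℝ) → ℝ) :
    gradedSpline q p k (a • F) = a • gradedSpline q p k F := by
  induction k with
  | zero => funext x; exact interp_smul a F x
  | succ k ih =>
    funext x
    rw [Pi.smul_apply, smul_eq_mul]
    simp only [gradedSpline]
    rw [← interp_smul]
    congr 1
    funext y
    rw [ih]
    simp only [Pi.smul_apply]
    split_ifs <;> rfl

/-- Dyadic grids are nested, so a spline on a coarser grid is a single polynomial on each finer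
cell. -/
lemma exists_coarse_cell {n n' : ℕ} (h : n ≤ n') (c : ℤ) : ∃ c₀ : ℤ, ∀ t : ℝ,
    (c : ℝ) ≤ (2 ^ n' : ℕ) * t ∧ (2 ^ n' : ℕ) * t ≤ c + 1 →
      (c₀ : ℝ) ≤ (2 ^ n : ℕ) * t ∧ (2 ^ n : ℕ) * t ≤ c₀ + 1 := by
  obtain ⟨d, rfl⟩ := Nat.exists_eq_add_of_le h
  have hd : (0 : ℤ) < 2 ^ d := by positivity
  have hd' : (0 : ℝ) < 2 ^ d := by positivity
  refine ⟨c / 2 ^ d, fun t ht => ?_⟩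
  have h1 : ((c / 2 ^ d : ℤ) : ℝ) * 2 ^ d ≤ c := by exact_mod_cast Int.ediv_mul_le c hd.ne'
  have h2 : (c + 1 : ℝ) ≤ ((c / 2 ^ d : ℤ) + 1 : ℝ) * 2 ^ d := by
    exact_mod_cast Int.lt_ediv_add_one_mul_self c hd
  have hpow : ((2 ^ (n + d) : ℕ) : ℝ) * t = (((2 ^ n : ℕ) : ℝ) * t) * 2 ^ d := by
    push_cast; rw [pow_add]; ring
  rw [hpow] at ht
  exact ⟨le_of_mul_le_mul_right (h1.trans ht.1) hd', le_of_mul_le_mul_right (ht.2.trans h2) hd'⟩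

/-- The inner cube is a union of fine cells, and all nodes of these cells carry values of the
coarser spline. That spline is polynomial on each fine cell, hence reproduced there. -/
lemma gradedSpline_succ_eq (hq : 0 < q) (hp : Monotone p) {k : ℕ} (hk : k + 3 ≤ p (k + 1))
    (F : (Fin l → ℝ) → ℝ) {x : Fin l → ℝ} (hx : ∀ i, |x i| ≤ 1 - (1 / 2) ^ (k + 1)) :
    gradedSpline q p (k + 1) F x = gradedSpline q p k F x := by
  have hcast := cast_innerRadius (p := p) (k := k + 1) hk
  have hcell : ∀ i, ∃ c ∈ Finset.Ico (-innerRadius p (k + 1)) (innerRadius p (k + 1)),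
      (c : ℝ) ≤ ((2 ^ p (k + 1) : ℕ) : ℝ) * x i ∧ ((2 ^ p (k + 1) : ℕ) : ℝ) * x i ≤ c + 1 :=
    fun i => exists_cell_of_abs_le (innerRadius_pos hk) ((abs_le_iff_scaled hcast).1 (hx i))
  choose c hc hxc using hcell
  have hG : 0 < 2 ^ p (k + 1) := by positivity
  obtain ⟨F', hF'⟩ := exists_gradedSpline_eq_interp (q := q) (p := p) k F
  have hin : ∀ z ∈ gridCell (2 ^ p (k + 1)) c, ∀ i, |z i| ≤ 1 - (1 / 2) ^ (k + 1) := fun z hz i =>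
    (abs_le_iff_scaled hcast).2 (abs_le_of_mem_cell (hc i) (hz i))
  have hcong : gradedSpline q p (k + 1) F x =
      interp q (2 ^ p (k + 1)) (gradedSpline q p k F) x :=
    interp_congr hq hG (fun m _ hm => if_pos (hin _ hm)) hxc
  rw [hcong]
  refine interp_eq_self hq hG (fun i => ?_) (fun z _ i => ?_) hxc
  · have h1 := Finset.mem_Ico.1 (hc i)
    have h2 : (0 : ℤ) < 2 ^ (p (k + 1) - (k + 1)) := by positivity
    unfold innerRadius at h1
    push_cast
    constructor <;> omega
  · obtain ⟨c₀, hc₀⟩ := exists_coarse_cell (hp (Nat.le_succ k)) (c i)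
    obtain ⟨R, hR, hRe⟩ := exists_polynomial_interp_update (G := 2 ^ p k) hq (c := fun _ => c₀) F' z i
    exact ⟨R, hR, fun t ht => by rw [hF']; exact hRe t (hc₀ t ht)⟩

lemma gradedSpline_eq_of_le (hq : 0 < q) (hp : Monotone p) (hpk : ∀ k ≤ K, k + 2 ≤ p k) {k : ℕ}
    (hk : k ≤ K) (F : (Fin l → ℝ) → ℝ) {x : Fin l → ℝ} (hx : ∀ i, |x i| ≤ shellRadius K k) :
    gradedSpline q p K F x = gradedSpline q p k F x := by
  rcases hk.lt_or_eq with hlt | rfl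
  · have key : ∀ n, k ≤ n → n ≤ K → gradedSpline q p n F x = gradedSpline q p k F x := by
      intro n hn
      induction n, hn using Nat.le_induction with
      | base => intro _; rfl
      | succ n hn ih =>
        intro hnK
        rw [gradedSpline_succ_eq hq hp (hpk (n + 1) hnK) F fun i => ?_, ih (by omega)]
        have h1 := hx i
        rw [shellRadius, if_pos hlt] at h1
        have h2 : (1 / 2 : ℝ) ^ (n + 1) ≤ (1 / 2) ^ (k + 1) :=
          pow_le_pow_of_le_one (by norm_num) (by norm_num) (by omega)
        linarith
    exact key K hk le_rfl
  · rfl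

/-- A node on the inner boundary of a shell lies in a cell of the preceding shell on which the spline
is the plain interpolant. -/
lemma exists_cell_of_mem_inner (hq : 0 < q) (hpk : ∀ k ≤ K, k + 2 ≤ p k) {k : ℕ} (hk : k + 1 ≤ K)
    {c : Fin l → ℤ} (hc : c ∈ shellCells l p K (k + 1)) {y : Fin l → ℝ}
    (hyc : y ∈ gridCell (2 ^ p (k + 1)) c) (hy : ∀ i, |y i| ≤ 1 - (1 / 2) ^ (k + 1)) :
    ∃ c' ∈ shellCells l p K k, y ∈ gridCell (2 ^ p k) c' ∧ ∀ F : (Fin l → ℝ) → ℝ,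
      ∀ x ∈ gridCell (2 ^ p k) c', gradedSpline q p k F x = interp q (2 ^ p k) F x := by
  have hk2 := hpk k (by omega)
  obtain ⟨i, hi⟩ := (mem_shellCells.1 hc).2
  -- A cell of shell k + 1 lies outside the inner cube in the direction i, so y is exactly on the
  -- interface.
  have hyi : |y i| = 1 - (1 / 2) ^ (k + 1) := by
    refine le_antisymm (hy i) ?_
    have h1 := le_abs_of_mem_cell hi (hyc i)
    rw [cast_innerRadius (hpk _ hk), abs_mul, Nat.abs_cast] at h1
    push_cast at h1
    exact le_of_mul_le_mul_left h1 (by positivity)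
  have hcell : ∀ j, ∃ c ∈ Finset.Ico (-outerRadius p K k) (outerRadius p K k),
      (c : ℝ) ≤ ((2 ^ p k : ℕ) : ℝ) * y j ∧ ((2 ^ p k : ℕ) : ℝ) * y j ≤ c + 1 := fun j => by
    refine exists_cell_of_abs_le (outerRadius_pos hk2)
      ((abs_le_iff_scaled (cast_outerRadius hk2)).1 ?_)
    rw [shellRadius, if_pos (by omega)]
    exact hy j
  choose c' hc' hyc' using hcell
  have h2p : (0 : ℝ) < 2 ^ p k := by positivity
  -- Shell k has thickness at least 2^-(k+1), two of its cells because p k ≥ k + 2. A cell touching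
  -- its outer face therefore misses the inner one, where nodal values are modified.
  have hfar : ∀ x ∈ gridCell (2 ^ p k) c', 1 - (1 / 2 : ℝ) ^ k < |x i| := by
    intro x hx
    have h1 : |((2 ^ p k : ℕ) : ℝ) * y i| - |((2 ^ p k : ℕ) : ℝ) * x i| ≤ 1 := by
      refine (abs_sub_abs_le_abs_sub _ _).trans (abs_le.2 ⟨?_, ?_⟩) <;>
        linarith [(hx i).1, (hx i).2, (hyc' i).1, (hyc' i).2]
    rw [abs_mul, abs_mul, Nat.abs_cast, hyi] at h1
    push_cast at h1
    have h3 : (2 : ℝ) ≤ 2 ^ p k * (1 / 2) ^ (k + 1) := by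
      have : (2 : ℝ) ^ p k = 2 ^ (p k - (k + 1)) * 2 ^ (k + 1) := by
        rw [← pow_add, Nat.sub_add_cancel (by omega)]
      rw [this, mul_assoc, ← mul_pow]
      norm_num
      exact le_self_pow₀ (by norm_num) (by omega)
    have h4 : (1 / 2 : ℝ) ^ k = 2 * (1 / 2) ^ (k + 1) := by rw [pow_succ]; ring
    rw [h4]
    refine lt_of_mul_lt_mul_left ?_ h2p.le
    linarith
  refine ⟨c', mem_shellCells.2 ⟨hc', i, fun hin => ?_⟩, hyc', fun F x hx => ?_⟩
  · have := (abs_le_iff_scaled (cast_innerRadius hk2)).2 (abs_le_of_mem_cell hin (hyc' i))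
    exact absurd this (not_le.2 (hfar y hyc'))
  · cases k with
    | zero => rfl
    | succ k =>
      exact interp_congr hq (by positivity)
        (fun m _ hm => if_neg fun hcon => absurd (hcon i) (not_le.2 (hfar _ hm))) hx

/-- The modified nodal values on a cell come from the plain interpolant of the preceding shell and
are thus off by at most ε. The Lebesgue factor enters once, whatever the number of shells. -/
lemma abs_sub_gradedSpline_le (hq : 0 < q) (hp : Monotone p) (hpk : ∀ k ≤ K, k + 2 ≤ p k)
    {F : (Fin l → ℝ) → ℝ} {ε : ℝ}
    (hε : ∀ k ≤ K, ∀ c ∈ shellCells l p K k, ∀ x ∈ gridCell (2 ^ p k) c,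
      |F x - interp q (2 ^ p k) F x| ≤ ε) {k : ℕ} (hk : k ≤ K) {c : Fin l → ℤ}
    (hc : c ∈ shellCells l p K k) {x : Fin l → ℝ} (hx : x ∈ gridCell (2 ^ p k) c) :
    |F x - gradedSpline q p K F x| ≤ (1 + lebesgueBound q ^ l) * ε := by
  have hε0 : 0 ≤ ε := (abs_nonneg _).trans (hε k hk c hc x hx)
  have hΛ := one_le_lebesgueBound hq
  rw [gradedSpline_eq_of_le hq hp hpk hk F (abs_le_shellRadius (hpk k hk) hc hx)]
  cases k with
  | zero =>
    refine (hε 0 hk c hc x hx).trans ?_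
    have : 0 ≤ lebesgueBound q ^ l * ε := by positivity
    linarith
  | succ k =>
    have h1 : |interp q (2 ^ p (k + 1)) F x - gradedSpline q p (k + 1) F x| ≤
        lebesgueBound q ^ l * ε := by
      refine abs_interp_sub_interp_le hq (by positivity) (fun m _ hm => ?_) hε0 hx
      split_ifs with hin
      · obtain ⟨c', hc', hyc', heq⟩ := exists_cell_of_mem_inner hq hpk hk hc hm hin
        rw [heq F _ hyc']
        exact hε k (by omega) c' hc' _ hyc'
      · rwa [sub_self, abs_zero]
    have := abs_sub_le (F x) (interp q (2 ^ p (k + 1)) F x) (gradedSpline q p (k + 1) F x)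
    have := hε (k + 1) hk c hc x hx
    linarith

/-- Locality: a modified node lies in a touching cell of the preceding shell, where its value is a
plain interpolant of nodal values of that cell. -/
lemma gradedSpline_congr (hq : 0 < q) (hp : Monotone p) (hpk : ∀ k ≤ K, k + 2 ≤ p k)
    {F F' : (Fin l → ℝ) → ℝ} {k : ℕ} (hk : k ≤ K) {c : Fin l → ℤ} (hc : c ∈ shellCells l p K k)
    (h : ∀ k' ≤ K, ∀ c' ∈ shellCells l p K k',
      (gridCell (2 ^ p k') c' ∩ gridCell (2 ^ p k) c).Nonempty → ∀ m,
        gridNode q (2 ^ p k') m ∈ gridCell (2 ^ p k') c' →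
          F (gridNode q (2 ^ p k') m) = F' (gridNode q (2 ^ p k') m))
    {x : Fin l → ℝ} (hx : x ∈ gridCell (2 ^ p k) c) :
    gradedSpline q p K F x = gradedSpline q p K F' x := by
  have hxr := abs_le_shellRadius (hpk k hk) hc hx
  rw [gradedSpline_eq_of_le hq hp hpk hk F hxr, gradedSpline_eq_of_le hq hp hpk hk F' hxr]
  cases k with
  | zero => exact interp_congr hq (by positivity) (fun m _ hm => h 0 hk c hc ⟨x, hx, hx⟩ m hm) hx
  | succ k =>
    refine interp_congr hq (by positivity) (fun m _ hm => ?_) hx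
    split_ifs with hin
    · obtain ⟨c', hc', hyc', heq⟩ := exists_cell_of_mem_inner hq hpk hk hc hm hin
      rw [heq F _ hyc', heq F' _ hyc']
      exact interp_congr hq (by positivity)
        (fun m' _ hm' => h k (by omega) c' hc' ⟨_, hyc', hm⟩ m' hm') hyc'
    · exact h (k + 1) hk c hc ⟨x, hx, hx⟩ m hm

/-- The right shell is the first whose outer cube contains x. By minimality the cell found there is
not inside the inner cube; for k = 0 the inner radius is zero. -/
lemma exists_mem_shellCells (hl : 0 < l) (hpk : ∀ k ≤ K, k + 2 ≤ p k) {x : Fin l → ℝ}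
    (hx : x ∈ cube l) : ∃ k ≤ K, ∃ c ∈ shellCells l p K k, x ∈ gridCell (2 ^ p k) c := by
  classical
  have hex : ∃ k, k ≤ K ∧ ∀ i, |x i| ≤ shellRadius K k :=
    ⟨K, le_rfl, fun i => by rw [shellRadius, if_neg (lt_irrefl K)]; exact mem_cube_iff.1 hx i⟩
  obtain ⟨hkK, hkx⟩ := Nat.find_spec hex
  have hmin := fun m => Nat.find_min hex (m := m)
  set k := Nat.find hex
  have hk2 := hpk k hkK
  have hcell : ∀ j, ∃ c ∈ Finset.Ico (-outerRadius p K k) (outerRadius p K k),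
      (c : ℝ) ≤ ((2 ^ p k : ℕ) : ℝ) * x j ∧ ((2 ^ p k : ℕ) : ℝ) * x j ≤ c + 1 := fun j =>
    exists_cell_of_abs_le (outerRadius_pos hk2)
      ((abs_le_iff_scaled (cast_outerRadius hk2)).1 (hkx j))
  choose c hc hxc using hcell
  refine ⟨k, hkK, c, mem_shellCells.2 ⟨hc, ?_⟩, hxc⟩
  by_contra! hin
  have hle : ∀ i, |x i| ≤ 1 - (1 / 2) ^ k := fun i =>
    (abs_le_iff_scaled (cast_innerRadius hk2)).2 (abs_le_of_mem_cell (hin i) (hxc i))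
  rcases Nat.eq_zero_or_pos k with h0 | h0
  · have := hin ⟨0, hl⟩
    simp [h0, innerRadius] at this
  · refine hmin (k - 1) (by omega) ⟨by omega, fun i => ?_⟩
    rw [shellRadius, if_pos (by omega), Nat.sub_add_cancel h0]
    exact hle i

end GradedSpline

/-! ### The box partition, its nodes and the spline operator, with their cardinalities. -/

section SplineMethod

variable {l q K : ℕ} {p : ℕ → ℕ}

/-- The dyadic box of edge length `2⁻ⁿ` with index `c`. -/
def dyadicBox (n : ℕ) (c : Fin l → ℤ) : BoxIntegral.Box (Fin l) where
  lower := fun i => c i / 2 ^ n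
  upper := fun i => (c i + 1) / 2 ^ n
  lower_lt_upper := fun i => by
    have : (0 : ℝ) < 2 ^ n := by positivity
    exact div_lt_div_of_pos_right (lt_add_one _) this

lemma mem_dyadicBox {n : ℕ} {c : Fin l → ℤ} {x : Fin l → ℝ} :
    x ∈ dyadicBox n c ↔ ∀ i, (c i : ℝ) < (2 ^ n : ℕ) * x i ∧ (2 ^ n : ℕ) * x i ≤ c i + 1 := by
  have : (0 : ℝ) < 2 ^ n := by positivity
  rw [BoxIntegral.Box.mem_def]
  refine forall_congr' fun i => ?_
  rw [Set.mem_Ioc]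
  simp only [dyadicBox]
  rw [div_lt_iff₀ this, le_div_iff₀ this, mul_comm (x i)]
  push_cast
  rfl

lemma Icc_dyadicBox (n : ℕ) (c : Fin l → ℤ) :
    BoxIntegral.Box.Icc (dyadicBox n c) = gridCell (2 ^ n) c := by
  have : (0 : ℝ) < 2 ^ n := by positivity
  ext x
  rw [BoxIntegral.Box.Icc_def, Set.mem_Icc, Pi.le_def, Pi.le_def, ← forall_and]
  refine forall_congr' fun i => ?_
  simp only [dyadicBox]
  rw [div_le_iff₀ this, le_div_iff₀ this, mul_comm (x i)]
  push_cast
  rfl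

lemma mem_Ioc_iff_scaled {n : ℕ} {A : ℤ} {ρ t : ℝ} (hA : (A : ℝ) = 2 ^ n * ρ) :
    (-ρ < t ∧ t ≤ ρ) ↔ (-(A : ℝ) < (2 ^ n : ℕ) * t ∧ (2 ^ n : ℕ) * t ≤ A) := by
  have h2 : (0 : ℝ) < 2 ^ n := by positivity
  push_cast
  rw [hA, mul_le_mul_iff_right₀ h2, ← mul_neg, mul_lt_mul_iff_right₀ h2]

lemma mem_Ioc_of_mem_Ico {A c : ℤ} (hc : c ∈ Finset.Ico (-A) A) {y : ℝ}
    (h : (c : ℝ) < y ∧ y ≤ c + 1) : -(A : ℝ) < y ∧ y ≤ A := by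
  rw [Finset.mem_Ico] at hc
  have h1 : (-A : ℝ) ≤ c := by exact_mod_cast hc.1
  have h2 : (c + 1 : ℝ) ≤ A := by exact_mod_cast hc.2
  constructor <;> linarith

lemma notMem_Ioc_of_notMem_Ico {A c : ℤ} (hc : c ∉ Finset.Ico (-A) A) {y : ℝ}
    (h : (c : ℝ) < y ∧ y ≤ c + 1) : ¬(-(A : ℝ) < y ∧ y ≤ A) := by
  rw [Finset.mem_Ico, not_and_or, not_le, not_lt] at hc
  rintro ⟨h3, h4⟩
  rcases hc with hc | hc
  · have h1 : (c + 1 : ℝ) ≤ -A := by exact_mod_cast hc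
    linarith [h.2]
  · have h1 : (A : ℝ) ≤ c := by exact_mod_cast hc
    linarith [h.1]

lemma mem_Ioc_shellRadius {k : ℕ} (hk : k + 2 ≤ p k) {c : Fin l → ℤ} (hc : c ∈ shellCells l p K k)
    {x : Fin l → ℝ} (hx : x ∈ dyadicBox (p k) c) (i : Fin l) :
    -shellRadius K k < x i ∧ x i ≤ shellRadius K k :=
  (mem_Ioc_iff_scaled (cast_outerRadius hk)).2
    (mem_Ioc_of_mem_Ico ((mem_shellCells.1 hc).1 i) (mem_dyadicBox.1 hx i))

/-- Boxes are open on the left and closed on the right, so the covering needed for a partition is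
redone with ceilings instead of floors. -/
lemma exists_mem_dyadicBox (hl : 0 < l) (hpk : ∀ k ≤ K, k + 2 ≤ p k) {x : Fin l → ℝ}
    (hx : ∀ i, -1 < x i ∧ x i ≤ 1) :
    ∃ k ≤ K, ∃ c ∈ shellCells l p K k, x ∈ dyadicBox (p k) c := by
  classical
  have hex : ∃ k, k ≤ K ∧ ∀ i, -shellRadius K k < x i ∧ x i ≤ shellRadius K k :=
    ⟨K, le_rfl, fun i => by rw [shellRadius, if_neg (lt_irrefl K)]; exact hx i⟩
  obtain ⟨hkK, hkx⟩ := Nat.find_spec hex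
  have hmin := fun m => Nat.find_min hex (m := m)
  set k := Nat.find hex
  have hk2 := hpk k hkK
  have hcell : x ∈ dyadicBox (p k) fun i => ⌈((2 ^ p k : ℕ) : ℝ) * x i⌉ - 1 := by
    refine mem_dyadicBox.2 fun i => ⟨?_, ?_⟩
    · push_cast
      linarith [Int.ceil_lt_add_one (2 ^ p k * x i)]
    · push_cast
      linarith [Int.le_ceil (2 ^ p k * x i)]
  refine ⟨k, hkK, _, mem_shellCells.2 ⟨fun i => ?_, ?_⟩, hcell⟩
  · by_contra hcon
    exact notMem_Ioc_of_notMem_Ico hcon (mem_dyadicBox.1 hcell i)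
      ((mem_Ioc_iff_scaled (cast_outerRadius hk2)).1 (hkx i))
  · by_contra! hin
    have hle : ∀ i, -(1 - (1 / 2 : ℝ) ^ k) < x i ∧ x i ≤ 1 - (1 / 2) ^ k := fun i =>
      (mem_Ioc_iff_scaled (cast_innerRadius hk2)).2
        (mem_Ioc_of_mem_Ico (hin i) (mem_dyadicBox.1 hcell i))
    rcases Nat.eq_zero_or_pos k with h0 | h0
    · have := hin ⟨0, hl⟩
      simp only [h0, innerRadius] at this
      simp at this
    · refine hmin (k - 1) (by omega) ⟨by omega, fun i => ?_⟩
      rw [shellRadius, if_pos (by omega), Nat.sub_add_cancel h0]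
      exact hle i

lemma disjoint_dyadicBox_of_lt (hpk : ∀ k ≤ K, k + 2 ≤ p k) {k k' : ℕ} (hkk' : k < k') (hk' : k' ≤ K)
    {c c' : Fin l → ℤ} (hc : c ∈ shellCells l p K k) (hc' : c' ∈ shellCells l p K k')
    {x : Fin l → ℝ} (hx : x ∈ dyadicBox (p k) c) : x ∉ dyadicBox (p k') c' := by
  intro hx'
  obtain ⟨i, hi⟩ := (mem_shellCells.1 hc').2
  have h1 := mem_Ioc_shellRadius (hpk k (by omega)) hc hx i
  rw [shellRadius, if_pos (by omega)] at h1
  have h2 : (1 / 2 : ℝ) ^ k' ≤ (1 / 2) ^ (k + 1) :=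
    pow_le_pow_of_le_one (by norm_num) (by norm_num) (by omega)
  exact notMem_Ioc_of_notMem_Ico hi (mem_dyadicBox.1 hx' i)
    ((mem_Ioc_iff_scaled (cast_innerRadius (hpk k' hk'))).1 ⟨by linarith [h1.1], by linarith [h1.2]⟩)

lemma eq_of_mem_dyadicBox {n : ℕ} {c c' : Fin l → ℤ} {x : Fin l → ℝ} (hx : x ∈ dyadicBox n c)
    (hx' : x ∈ dyadicBox n c') : c = c' := by
  funext i
  have h := mem_dyadicBox.1 hx i
  have h' := mem_dyadicBox.1 hx' i
  have h1 : (c i : ℝ) < c' i + 1 := h.1.trans_le h'.2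
  have h2 : (c' i : ℝ) < c i + 1 := h'.1.trans_le h.2
  have h1 : c i < c' i + 1 := by exact_mod_cast h1
  have h2 : c' i < c i + 1 := by exact_mod_cast h2
  omega

lemma eq_of_mem_shell_dyadicBox (hpk : ∀ k ≤ K, k + 2 ≤ p k) {k k' : ℕ} (hk : k ≤ K) (hk' : k' ≤ K)
    {c c' : Fin l → ℤ} (hc : c ∈ shellCells l p K k) (hc' : c' ∈ shellCells l p K k')
    {x : Fin l → ℝ} (hx : x ∈ dyadicBox (p k) c) (hx' : x ∈ dyadicBox (p k') c') :
    dyadicBox (p k) c = dyadicBox (p k') c' := by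
  rcases lt_trichotomy k k' with h | h | h
  · exact absurd hx' (disjoint_dyadicBox_of_lt hpk h hk' hc hc' hx)
  · subst h; rw [eq_of_mem_dyadicBox hx hx']
  · exact absurd hx (disjoint_dyadicBox_of_lt hpk h hk hc' hc hx')

open Classical in
/-- The partition of the cube into the cells of the shells. -/
def shellPartition (l : ℕ) (hpk : ∀ k ≤ K, k + 2 ≤ p k) :
    BoxIntegral.Prepartition (cubeBox l) where
  boxes := (Finset.range (K + 1)).biUnion fun k => (shellCells l p K k).image (dyadicBox (p k))
  le_of_mem' := by
    intro J hJ
    simp only [Finset.mem_biUnion, Finset.mem_range, Finset.mem_image] at hJ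
    obtain ⟨k, hk, c, hc, rfl⟩ := hJ
    rw [BoxIntegral.Box.le_def]
    intro x hx i
    have h1 := mem_Ioc_shellRadius (hpk k (by omega)) hc hx i
    have h2 := shellRadius_le_one (K := K) k
    exact ⟨by simp only [cubeBox, Pi.neg_apply, Pi.one_apply]; linarith [h1.1],
      by simp only [cubeBox, Pi.one_apply]; linarith [h1.2]⟩
  pairwiseDisjoint := by
    intro J hJ J' hJ' hne
    simp only [Finset.coe_biUnion, Set.mem_iUnion, Finset.mem_coe, Finset.mem_range,
      Finset.mem_image, exists_prop] at hJ hJ'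
    obtain ⟨k, hk, c, hc, rfl⟩ := hJ
    obtain ⟨k', hk', c', hc', rfl⟩ := hJ'
    refine Set.disjoint_left.2 fun x hx hx' => hne ?_
    exact eq_of_mem_shell_dyadicBox hpk (by omega) (by omega) hc hc' hx hx'

lemma mem_shellPartition {hpk : ∀ k ≤ K, k + 2 ≤ p k} {J : BoxIntegral.Box (Fin l)} :
    J ∈ shellPartition l hpk ↔ ∃ k ≤ K, ∃ c ∈ shellCells l p K k, dyadicBox (p k) c = J := by
  rw [← BoxIntegral.Prepartition.mem_boxes]
  simp [shellPartition]

lemma isPartition_shellPartition (hl : 0 < l) (hpk : ∀ k ≤ K, k + 2 ≤ p k) :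
    (shellPartition l hpk).IsPartition := by
  intro x hx
  obtain ⟨k, hk, c, hc, hxc⟩ := exists_mem_dyadicBox hl hpk (x := x) fun i => by
    have := hx i
    simpa [cubeBox] using this
  exact ⟨_, mem_shellPartition.2 ⟨k, hk, c, hc, rfl⟩, hxc⟩

lemma card_shellPartition_le (hpk : ∀ k ≤ K, k + 2 ≤ p k) :
    (shellPartition l hpk).boxes.card ≤ ∑ k ∈ Finset.range (K + 1), (shellCells l p K k).card := by
  classical
  exact Finset.card_biUnion_le.trans (Finset.sum_le_sum fun _ _ => Finset.card_image_le)

open Classical in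
/-- The nodes of the cells of the shells. -/
def shellNodes (l q K : ℕ) (p : ℕ → ℕ) : Finset (Fin l → ℝ) :=
  (Finset.range (K + 1)).biUnion fun k => (shellCells l p K k).biUnion fun c =>
    (Fintype.piFinset fun i => Finset.Icc (q * c i) (q * c i + q)).image (gridNode q (2 ^ p k))

lemma card_shellNodes_le :
    (shellNodes l q K p).card ≤
      (∑ k ∈ Finset.range (K + 1), (shellCells l p K k).card) * (q + 1) ^ l := by
  rw [Finset.sum_mul]
  refine Finset.card_biUnion_le.trans (Finset.sum_le_sum fun k _ => ?_)
  refine Finset.card_biUnion_le_card_mul _ _ _ fun c _ => Finset.card_image_le.trans ?_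
  rw [Fintype.card_piFinset]
  simp only [card_cell_nodes]
  simp

lemma gridNode_mem_shellNodes (hq : 0 < q) {k : ℕ} (hk : k ≤ K) {c : Fin l → ℤ}
    (hc : c ∈ shellCells l p K k) {m : Fin l → ℤ}
    (hm : gridNode q (2 ^ p k) m ∈ gridCell (2 ^ p k) c) :
    gridNode q (2 ^ p k) m ∈ shellNodes l q K p := by
  simp only [shellNodes, Finset.mem_biUnion, Finset.mem_range, Finset.mem_image,
    Fintype.mem_piFinset]
  exact ⟨k, by omega, c, hc, m, fun i => (mem_cell_nodes_iff hq (by positivity)).2 (hm i), rfl⟩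

open Classical in
/-- The extension by zero of a function on the cube. -/
def extendZero (f : C(cube l, ℝ)) (x : Fin l → ℝ) : ℝ := if h : x ∈ cube l then f ⟨x, h⟩ else 0

lemma extendZero_coe (f : C(cube l, ℝ)) (t : cube l) : extendZero f t = f t := by
  rw [extendZero, dif_pos t.2]

/-- The spline operator of a graded grid. -/
def splineOp (l : ℕ) (hq : 0 < q) (p : ℕ → ℕ) (K : ℕ) : C(cube l, ℝ) →ₗ[ℝ] C(cube l, ℝ) where
  toFun f := ⟨fun t => gradedSpline q p K (extendZero f) t,
    (continuous_gradedSpline hq K _).comp continuous_subtype_val⟩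
  map_add' f f' := by
    ext t
    have : extendZero (f + f') = extendZero f + extendZero f' := by
      funext x
      simp only [extendZero, Pi.add_apply]
      split_ifs <;> simp
    simp [this, gradedSpline_add]
  map_smul' a f := by
    ext t
    have : extendZero (a • f) = a • extendZero f := by
      funext x
      simp only [extendZero, Pi.smul_apply]
      split_ifs <;> simp
    simp [this, gradedSpline_smul]

lemma splineOp_apply (hq : 0 < q) (f : C(cube l, ℝ)) (t : cube l) :
    splineOp l hq p K f t = gradedSpline q p K (extendZero f) t := rfl

lemma isLocalSplineMethod_splineOp (hl : 0 < l) (hq : 0 < q) (hp : Monotone p)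
    (hpk : ∀ k ≤ K, k + 2 ≤ p k) {n : ℕ}
    (hn : (∑ k ∈ Finset.range (K + 1), (shellCells l p K k).card) * (q + 1) ^ l ≤ n) :
    IsLocalSplineMethod q n (splineOp l hq p K) := by
  classical
  refine ⟨shellPartition l hpk, (shellNodes l q K p).subtype (· ∈ cube l),
    isPartition_shellPartition hl hpk, ?_, ?_, ?_, ?_⟩
  -- The single budget of (q + 1)^l nodes per cell also covers the number of boxes.
  · exact (card_shellPartition_le hpk).trans
      ((Nat.le_mul_of_pos_right _ (by positivity)).trans hn)
  · rw [Finset.card_subtype]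
    exact (Finset.card_filter_le _ _).trans (card_shellNodes_le.trans hn)
  · intro f J hJ
    obtain ⟨k, hk, c, hc, rfl⟩ := mem_shellPartition.1 hJ
    obtain ⟨F', hF'⟩ := exists_gradedSpline_eq_interp (q := q) (p := p) k (extendZero f)
    obtain ⟨P, hP, hPe⟩ := exists_mvPolynomial_interp (G := 2 ^ p k) hq c F'
    refine ⟨P, hP, fun t ht => ?_⟩
    rw [Icc_dyadicBox] at ht
    rw [splineOp_apply, gradedSpline_eq_of_le hq hp hpk hk _ (abs_le_shellRadius (hpk k hk) hc ht),
      hF', hPe _ ht]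
  · intro J hJ f g hfg t ht
    obtain ⟨k, hk, c, hc, rfl⟩ := mem_shellPartition.1 hJ
    rw [Icc_dyadicBox] at ht
    rw [splineOp_apply, splineOp_apply]
    refine gradedSpline_congr hq hp hpk hk hc (fun k' hk' c' hc' hne m hm => ?_) ht
    have hmem := mem_cube_of_mem_shell (hpk k' hk') hc' hm
    rw [extendZero, extendZero, dif_pos hmem, dif_pos hmem]
    refine hfg _ (mem_shellPartition.2 ⟨k', hk', c', hc', rfl⟩) ?_ _ ?_ ?_
    · rwa [Icc_dyadicBox, Icc_dyadicBox]
    · rw [Finset.mem_subtype]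
      exact gridNode_mem_shellNodes hq hk' hc' hm
    · rwa [Icc_dyadicBox]

lemma pow_sub_pow_le_mul {α β : ℝ} (hβ : 0 ≤ β) (hβα : β ≤ α) (hα : α ≤ 1) (n : ℕ) :
    α ^ n - β ^ n ≤ n * (α - β) := by
  induction n with
  | zero => simp
  | succ n ih =>
    have h1 : β ^ n ≤ 1 := pow_le_one₀ hβ (hβα.trans hα)
    have h2 : β ^ n ≤ α ^ n := pow_le_pow_left₀ hβ hβα n
    rw [pow_succ, pow_succ]
    push_cast
    nlinarith

/-- A shell is a difference of two cubes whose radii differ by at most 2^-k, hence the gain of 2^-k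
over the count for the full cube. -/
lemma card_shellCells_le {k : ℕ} (hk : k + 2 ≤ p k) :
    ((shellCells l p K k).card : ℝ) ≤ 2 ^ l * l * (((2 : ℝ) ^ p k) ^ l * (1 / 2) ^ k) := by
  have h2 : (0 : ℝ) < 2 ^ p k := by positivity
  have hout := cast_outerRadius (K := K) hk
  have hin := cast_innerRadius hk
  have hpow : (0 : ℝ) < (1 / 2) ^ k := by positivity
  have hpow1 : (1 / 2 : ℝ) ^ k ≤ 1 := pow_le_one₀ (by norm_num) (by norm_num)
  have hrad : 1 - (1 / 2 : ℝ) ^ k ≤ shellRadius K k := by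
    unfold shellRadius
    split_ifs
    · rw [pow_succ]; linarith
    · linarith
  have hle : innerRadius p k ≤ outerRadius p K k := by
    have : (innerRadius p k : ℝ) ≤ outerRadius p K k := by
      rw [hin, hout]; exact mul_le_mul_of_nonneg_left hrad h2.le
    exact_mod_cast this
  have hin0 : 0 ≤ innerRadius p k := by
    have : (0 : ℝ) ≤ innerRadius p k := by rw [hin]; exact mul_nonneg h2.le (by linarith)
    exact_mod_cast this
  have hsub : Fintype.piFinset (fun _ : Fin l => Finset.Ico (-innerRadius p k) (innerRadius p k)) ⊆
      Fintype.piFinset (fun _ => Finset.Ico (-outerRadius p K k) (outerRadius p K k)) :=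
    Fintype.piFinset_subset _ _ fun _ => Finset.Ico_subset_Ico (by omega) hle
  rw [shellCells, Finset.cast_card_sdiff hsub, Fintype.card_piFinset, Fintype.card_piFinset]
  simp only [Int.card_Ico, Finset.prod_const, Finset.card_univ, Fintype.card_fin]
  have hc1 : (((outerRadius p K k - -outerRadius p K k).toNat : ℕ) : ℝ) =
      2 * 2 ^ p k * shellRadius K k := by
    have : (((outerRadius p K k - -outerRadius p K k).toNat : ℤ) : ℝ) =
        2 * 2 ^ p k * shellRadius K k := by
      rw [Int.toNat_of_nonneg (by omega)]; push_cast; rw [hout]; ring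
    exact_mod_cast this
  have hc2 : (((innerRadius p k - -innerRadius p k).toNat : ℕ) : ℝ) =
      2 * 2 ^ p k * (1 - (1 / 2) ^ k) := by
    have : (((innerRadius p k - -innerRadius p k).toNat : ℤ) : ℝ) =
        2 * 2 ^ p k * (1 - (1 / 2) ^ k) := by
      rw [Int.toNat_of_nonneg (by omega)]; push_cast; rw [hin]; ring
    exact_mod_cast this
  push_cast
  rw [hc1, hc2, mul_pow _ (shellRadius K k), mul_pow _ (1 - (1 / 2 : ℝ) ^ k), ← mul_sub, mul_pow]
  have := pow_sub_pow_le_mul (by linarith) hrad (shellRadius_le_one k) l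
  calc _ ≤ 2 ^ l * (2 ^ p k) ^ l * (l * (shellRadius K k - (1 - (1 / 2 : ℝ) ^ k))) := by gcongr
    _ ≤ 2 ^ l * (2 ^ p k) ^ l * (l * (1 / 2 : ℝ) ^ k) := by
        gcongr
        linarith [shellRadius_le_one (K := K) k]
    _ = _ := by ring

end SplineMethod

/-! ### From local spline methods to Kolmogorov widths. -/

section Width

/-- The width asks for subspaces of dimension exactly n, whereas the range of a spline operator may
be smaller; lines are added one at a time. -/
lemma exists_finrank_eq_of_le {V : Type*} [AddCommGroup V] [Module ℝ V]
    (hV : ¬FiniteDimensional ℝ V) (W : Submodule ℝ V) [FiniteDimensional ℝ W] {n : ℕ}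
    (hn : Module.finrank ℝ W ≤ n) :
    ∃ L : Submodule ℝ V, W ≤ L ∧ FiniteDimensional ℝ L ∧ Module.finrank ℝ L = n := by
  induction n, hn using Nat.le_induction with
  | base => exact ⟨W, le_rfl, inferInstance, rfl⟩
  | succ n _ ih =>
    obtain ⟨L, hWL, hL, hLn⟩ := ih
    have hne : L ≠ ⊤ := by
      rintro rfl
      exact hV (Module.Finite.equiv (Submodule.topEquiv (R := ℝ) (M := V)))
    obtain ⟨x, -, hx⟩ := SetLike.exists_of_lt hne.lt_top
    refine ⟨L ⊔ Submodule.span ℝ {x}, hWL.trans le_sup_left, inferInstance, ?_⟩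
    have hinf : L ⊓ Submodule.span ℝ {x} = ⊥ := by
      rw [← disjoint_iff, Submodule.disjoint_span_singleton]
      exact fun h => absurd h hx
    have hx0 : x ≠ 0 := fun h => hx (h ▸ L.zero_mem)
    have := Submodule.finrank_sup_add_finrank_inf_eq L (Submodule.span ℝ {x})
    rw [hinf, finrank_bot, finrank_span_singleton hx0, hLn] at this
    simpa using this

variable {l : ℕ}

lemma not_finiteDimensional_continuousMap_cube (hl : 0 < l) :
    ¬FiniteDimensional ℝ C(cube l, ℝ) := by
  intro hfin
  let i : Fin l := ⟨0, hl⟩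
  let ev : Polynomial ℝ →ₗ[ℝ] C(cube l, ℝ) :=
    { toFun := fun P => ⟨fun t => P.eval ((t : Fin l → ℝ) i),
        P.continuous.comp ((continuous_apply i).comp continuous_subtype_val)⟩
      map_add' := fun P R => by ext; simp
      map_smul' := fun a P => by ext; simp }
  have hinj : Function.Injective ev := by
    rw [injective_iff_map_eq_zero]
    intro P hP
    refine Polynomial.eq_zero_of_infinite_isRoot P ((Set.Icc_infinite zero_lt_one).mono ?_)
    intro τ hτ
    have ht : (fun _ => τ : Fin l → ℝ) ∈ cube l :=
      mem_cube_iff.2 fun _ => by rw [abs_of_nonneg hτ.1]; exact hτ.2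
    exact DFunLike.congr_fun hP ⟨_, ht⟩
  exact Polynomial.not_finite (R := ℝ) (Module.Finite.of_injective ev hinj)

/-- The half-open boxes miss the lower faces of the cube. The finite union of their closures is
closed and contains the half-open cube, hence the whole cube. -/
lemma exists_mem_Icc_of_isPartition {π : BoxIntegral.Prepartition (cubeBox l)}
    (hπ : π.IsPartition) {t : Fin l → ℝ} (ht : t ∈ cube l) :
    ∃ J ∈ π, t ∈ BoxIntegral.Box.Icc J := by
  have hclosed : IsClosed (⋃ J ∈ π.boxes, BoxIntegral.Box.Icc J) :=
    π.boxes.finite_toSet.isClosed_biUnion fun J _ => isClosed_Icc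
  have hsub : ((cubeBox l : BoxIntegral.Box (Fin l)) : Set (Fin l → ℝ)) ⊆
      ⋃ J ∈ π.boxes, BoxIntegral.Box.Icc J := fun x hx => by
    obtain ⟨J, hJ, hxJ⟩ := hπ x hx
    exact Set.mem_biUnion (x := J) hJ (BoxIntegral.Box.coe_subset_Icc hxJ)
  have hcl : t ∈ closure ((cubeBox l : BoxIntegral.Box (Fin l)) : Set (Fin l → ℝ)) := by
    rw [BoxIntegral.Box.coe_eq_pi, closure_pi_set, Set.mem_univ_pi]
    intro i
    rw [closure_Ioc ((cubeBox l).lower_lt_upper i).ne]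
    exact abs_le.1 (mem_cube_iff.1 ht i)
  obtain ⟨J, hJ, htJ⟩ := Set.mem_iUnion₂.1 (closure_minimal hsub hclosed hcl)
  exact ⟨J, hJ, htJ⟩

/-- By locality S f depends only on the values of f at the nodes, so S factors through the
evaluation map. A linear right inverse of that map onto its range makes the factorization explicit.
-/
lemma IsLocalSplineMethod.finrank_range_le {m n : ℕ} {S : C(cube l, ℝ) →ₗ[ℝ] C(cube l, ℝ)}
    (hS : IsLocalSplineMethod m n S) :
    FiniteDimensional ℝ (LinearMap.range S) ∧ Module.finrank ℝ (LinearMap.range S) ≤ n := by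
  obtain ⟨π, T, hπ, -, hT, -, hloc⟩ := hS
  let ev : C(cube l, ℝ) →ₗ[ℝ] (T → ℝ) :=
    { toFun := fun f x => f x
      map_add' := fun _ _ => rfl
      map_smul' := fun _ _ => rfl }
  obtain ⟨σ, hσ⟩ := LinearMap.exists_rightInverse_of_surjective ev.rangeRestrict
    ev.range_rangeRestrict
  have hfac : S = (S ∘ₗ σ) ∘ₗ ev.rangeRestrict := by
    refine LinearMap.ext fun f => ContinuousMap.ext fun t => ?_
    obtain ⟨J, hJ, htJ⟩ := exists_mem_Icc_of_isPartition hπ t.2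
    refine hloc J hJ f _ (fun J' _ _ x hx _ => ?_) t htJ
    have h1 : ev.rangeRestrict (σ (ev.rangeRestrict f)) = ev.rangeRestrict f :=
      LinearMap.congr_fun hσ _
    exact (congrFun (congrArg Subtype.val h1) ⟨x, hx⟩).symm
  have hle : LinearMap.range S ≤ LinearMap.range (S ∘ₗ σ) := by
    conv_lhs => rw [hfac]
    exact LinearMap.range_comp_le_range _ _
  refine ⟨Submodule.finiteDimensional_of_le hle, ?_⟩
  calc _ ≤ Module.finrank ℝ (LinearMap.range (S ∘ₗ σ)) := Submodule.finrank_mono hle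
    _ ≤ Module.finrank ℝ (LinearMap.range ev) := LinearMap.finrank_range_le _
    _ ≤ Module.finrank ℝ (T → ℝ) := Submodule.finrank_le _
    _ ≤ n := by rw [Module.finrank_fintype_fun_eq_card, Fintype.card_coe]; exact hT

/-- An upper bound by local splines is an upper bound of the Kolmogorov width. -/
lemma widthAndSplineBound_of_spline {r u m n : ℕ} {γ ε : ℝ} (hl : 0 < l)
    {S : C(cube l, ℝ) →ₗ[ℝ] C(cube l, ℝ)} (hS : IsLocalSplineMethod m n S)
    (h : ∀ f ∈ classQ l r u γ, ‖f - S f‖ ≤ ε) : WidthAndSplineBound l r u γ m n ε := by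
  refine ⟨?_, S, hS, h⟩
  obtain ⟨hfin, hrank⟩ := hS.finrank_range_le
  obtain ⟨L, hSL, hL, hLn⟩ :=
    exists_finrank_eq_of_le (not_finiteDimensional_continuousMap_cube hl) _ hrank
  refine iInf₂_le_of_le L ⟨hL, hLn⟩ (iSup₂_le fun f hf => ?_)
  refine (Metric.infEDist_le_edist_of_mem (hSL ⟨f, rfl⟩)).trans ?_
  rw [edist_dist, dist_eq_norm]
  exact ENNReal.ofReal_le_ofReal (h f hf)

/-- Serves the finitely many n too small for a graded grid: one box, one node at the origin, and
error 2 because |f| ≤ 1. -/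
lemma exists_constant_spline {r u n : ℕ} {γ : ℝ} (m : ℕ) (hn : 1 ≤ n) :
    ∃ S : C(cube l, ℝ) →ₗ[ℝ] C(cube l, ℝ), IsLocalSplineMethod m n S ∧
      ∀ f ∈ classQ l r u γ, ‖f - S f‖ ≤ 2 := by
  let o : cube l := ⟨0, mem_cube_iff.2 fun _ => by simp⟩
  refine ⟨{ toFun := fun f => ContinuousMap.const _ (f o)
            map_add' := fun _ _ => rfl
            map_smul' := fun _ _ => rfl }, ⟨⊤, {o}, BoxIntegral.Prepartition.isPartitionTop _,
    ?_, ?_, ?_, ?_⟩, ?_⟩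
  · simpa using hn
  · simpa using hn
  · exact fun f J _ => ⟨MvPolynomial.C (f o), fun i => by simp, fun t _ => by
      rw [MvPolynomial.eval_C]; rfl⟩
  · intro J hJ f g hfg t _
    rw [BoxIntegral.Prepartition.mem_top] at hJ
    subst hJ
    have ho : (o : Fin l → ℝ) ∈ BoxIntegral.Box.Icc (cubeBox l) := o.2
    exact hfg _ (BoxIntegral.Prepartition.mem_top.2 rfl) ⟨o, ho, ho⟩ o (by simp) ho
  · rintro f ⟨g, hgf, hg⟩
    have hf : ∀ t, |f t| ≤ 1 := fun t => by
      rw [← hgf t]; exact hg.bound_low [] (Nat.zero_le _) t t.2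
    refine (ContinuousMap.norm_le _ zero_le_two).2 fun t => ?_
    have h1 := hf t
    have h2 := hf o
    calc _ = |f t - f o| := rfl
      _ ≤ |f t| + |f o| := abs_sub _ _
      _ ≤ 2 := by linarith

end Width

/-! ### Interpolation error on the cells of a shell. -/

section CellError

variable {l r u q K : ℕ} {γ : ℝ} {p : ℕ → ℕ}

lemma cell_interval_iff {n : ℕ} {c : ℤ} {t : ℝ} :
    ((c : ℝ) ≤ (2 ^ n : ℕ) * t ∧ (2 ^ n : ℕ) * t ≤ c + 1) ↔
      t ∈ Set.Icc ((c : ℝ) / 2 ^ n) ((c + 1) / 2 ^ n) := by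
  have : (0 : ℝ) < 2 ^ n := by positivity
  rw [Set.mem_Icc, div_le_iff₀ this, le_div_iff₀ this, mul_comm t]
  push_cast
  rfl

lemma cell_interval_length (n : ℕ) (c : ℤ) :
    ((c : ℝ) + 1) / 2 ^ n - c / 2 ^ n = (1 / 2) ^ n := by
  rw [← sub_div, add_sub_cancel_left, one_div, one_div, inv_pow]

lemma cell_interval_bounds {k : ℕ} (hk : k + 2 ≤ p k) {c : Fin l → ℤ} (hc : c ∈ shellCells l p K k)
    (i : Fin l) : -shellRadius K k ≤ (c i : ℝ) / 2 ^ p k ∧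
      ((c i : ℝ) + 1) / 2 ^ p k ≤ shellRadius K k := by
  have h2 : (0 : ℝ) < 2 ^ p k := by positivity
  have h := Finset.mem_Ico.1 ((mem_shellCells.1 hc).1 i)
  have hout := cast_outerRadius (K := K) hk
  have h3 : (-outerRadius p K k : ℝ) ≤ c i := by exact_mod_cast h.1
  have h4 : (c i + 1 : ℝ) ≤ outerRadius p K k := by exact_mod_cast h.2
  rw [le_div_iff₀ h2, div_le_iff₀ h2]
  constructor <;> nlinarith

/-- For k < K the shell stays at distance at least 2^-(k+1) from the boundary, which is the origin
of k + 1 in the bound. -/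
lemma IsInClassQ.abs_sub_interp_le_inner {g : (Fin l → ℝ) → ℝ} (hl : 0 < l)
    (h : IsInClassQ l r u γ g) (hq : 0 < q) (hqs : q = r + ⌈γ⌉₊ - 1) (hγ : 0 < γ)
    (hζ : (⌈γ⌉₊ : ℝ) - γ ≤ 1) {F : (Fin l → ℝ) → ℝ} (hF : ∀ t ∈ cube l, F t = g t) {k : ℕ}
    (hk : k + 2 ≤ p k) (hkK : k < K) {c : Fin l → ℤ} (hc : c ∈ shellCells l p K k) {x : Fin l → ℝ}
    (hx : x ∈ gridCell (2 ^ p k) c) :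
    |F x - interp q (2 ^ p k) F x| ≤ l * lebesgueBound q ^ l * ((1 + lebesgueBound q) *
      (((1 / 2) ^ p k) ^ (r + ⌈γ⌉₊) * (2 * ((k + 1 : ℕ) + 1) ^ u * ((2 : ℝ) ^ γ) ^ (k + 1)))) := by
  refine abs_sub_interp_le hq (by positivity) (admissible_of_mem_shellCells hc) (by positivity)
    (fun z hz i => ?_) hx
  obtain ⟨ha, hb⟩ := cell_interval_bounds hk hc i
  have hzr := abs_le_shellRadius hk hc hz
  rw [shellRadius, if_pos hkK] at ha hb hzr
  have hlen := cell_interval_length (p k) (c i)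
  have hpos : (0 : ℝ) < (1 / 2) ^ p k := by positivity
  obtain ⟨R, hR, hRe⟩ := h.exists_polynomial_interior hl hγ hζ hzr i (by linarith) ha hb
  refine ⟨R, hqs ▸ hR, fun t ht => ?_⟩
  have hmem : Function.update z i t ∈ gridCell (2 ^ p k) c := fun j => by
    rcases eq_or_ne j i with rfl | hj
    · rwa [Function.update_self]
    · rw [Function.update_of_ne hj]; exact hz j
  rw [hF _ (mem_cube_of_mem_shell hk hc hmem), ← hlen]
  exact hRe t (cell_interval_iff.1 ht)

/-- Uses no distance from the boundary, only that the edge 2^-p_k is at most 2^-k. It is needed for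
the last shell. -/
lemma IsInClassQ.abs_sub_interp_le_outer {g : (Fin l → ℝ) → ℝ} (hl : 0 < l)
    (h : IsInClassQ l r u γ g) (hq : 0 < q) (hqs : q = r + ⌈γ⌉₊ - 1) (hγ : 0 < γ)
    (hζ : (⌈γ⌉₊ : ℝ) - γ ≤ 1) (hζ0 : 0 < (⌈γ⌉₊ : ℝ) - γ) {F : (Fin l → ℝ) → ℝ}
    (hF : ∀ t ∈ cube l, F t = g t) {k : ℕ} (hk : k + 2 ≤ p k) {c : Fin l → ℤ}
    (hc : c ∈ shellCells l p K k) {x : Fin l → ℝ} (hx : x ∈ gridCell (2 ^ p k) c) :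
    |F x - interp q (2 ^ p k) F x| ≤ l * lebesgueBound q ^ l * ((1 + lebesgueBound q) *
      (((1 / 2) ^ p k) ^ r * (oscConst l u ((1 / 2 : ℝ) ^ ((⌈γ⌉₊ : ℝ) - γ)) *
          ((k + 1) ^ u * ((1 / 2 : ℝ) ^ ((⌈γ⌉₊ : ℝ) - γ)) ^ k)))) := by
  have hosc : 0 ≤ oscConst l u ((1 / 2 : ℝ) ^ ((⌈γ⌉₊ : ℝ) - γ)) := by
    have : (0 : ℝ) ≤ ∑' j : ℕ, ((j : ℝ) + 2) ^ u * ((1 / 2 : ℝ) ^ ((⌈γ⌉₊ : ℝ) - γ)) ^ j :=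
      tsum_nonneg fun j => by positivity
    unfold oscConst
    positivity
  refine abs_sub_interp_le hq (by positivity) (admissible_of_mem_shellCells hc) (by positivity)
    (fun z hz i => ?_) hx
  obtain ⟨ha, hb⟩ := cell_interval_bounds hk hc i
  have hr1 := shellRadius_le_one (K := K) k
  have hlen := cell_interval_length (p k) (c i)
  have hpos : (0 : ℝ) < (1 / 2) ^ p k := by positivity
  obtain ⟨R, hR, hRe⟩ := h.exists_polynomial_closed (K := k) (a := (c i : ℝ) / 2 ^ p k)
    (b := (c i + 1) / 2 ^ p k) hl hγ hζ hζ0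
    (mem_cube_of_mem_shell hk hc hz) i (by linarith) (by linarith) (by linarith) (by
      rw [hlen]; exact pow_le_pow_of_le_one (by norm_num) (by norm_num) (by omega))
  refine ⟨R, hqs ▸ hR, fun t ht => ?_⟩
  have hmem : Function.update z i t ∈ gridCell (2 ^ p k) c := fun j => by
    rcases eq_or_ne j i with rfl | hj
    · rwa [Function.update_self]
    · rw [Function.update_of_ne hj]; exact hz j
  rw [hF _ (mem_cube_of_mem_shell hk hc hmem), ← hlen]
  exact hRe t (cell_interval_iff.1 ht)

end CellError

/-! ### Choice of the grid levels. -/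

section Levels

/-- The dyadic level of the grid on the shell of index `k`. -/
def shellLevel (s : ℕ) (γ' : ℝ) (K k : ℕ) : ℕ := ⌈((s - γ') * K + γ' * k) / s⌉₊ + 2

variable {s K k : ℕ} {γ' : ℝ}

lemma monotone_shellLevel (hγ' : 0 < γ') : Monotone (shellLevel s γ' K) := by
  intro k k' h
  have : (k : ℝ) ≤ k' := by exact_mod_cast h
  unfold shellLevel
  gcongr

/-- Before rounding, the level is a convex combination of K and k, hence at least k. The added 2
makes the shells two cells thick. -/
lemma add_two_le_shellLevel (hs : 0 < s) (hγs : γ' < s) (hk : k ≤ K) :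
    k + 2 ≤ shellLevel s γ' K k := by
  have hs' : (0 : ℝ) < s := by exact_mod_cast hs
  have hk' : (k : ℝ) ≤ K := by exact_mod_cast hk
  have h : (k : ℝ) ≤ ((s - γ') * K + γ' * k) / s := by rw [le_div_iff₀ hs']; nlinarith
  have : (k : ℝ) ≤ ⌈((s - γ') * K + γ' * k) / s⌉₊ := h.trans (Nat.le_ceil _)
  have : k ≤ ⌈((s - γ') * K + γ' * k) / s⌉₊ := by exact_mod_cast this
  unfold shellLevel
  omega

lemma le_mul_shellLevel (hs : 0 < s) :
    (s - γ') * K + γ' * k ≤ s * (shellLevel s γ' K k : ℝ) := by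
  have hs' : (0 : ℝ) < s := by exact_mod_cast hs
  have := Nat.le_ceil (((s - γ') * K + γ' * k) / s)
  rw [div_le_iff₀ hs'] at this
  unfold shellLevel
  push_cast
  nlinarith

lemma shellLevel_le (hγ' : 0 < γ') (hγs : γ' < s) :
    (shellLevel s γ' K k : ℝ) ≤ ((s - γ') * K + γ' * k) / s + 3 := by
  have hn : 0 ≤ ((s - γ') * K + γ' * k) / s := by
    have : 0 ≤ s - γ' := by linarith
    positivity
  have := (Nat.ceil_lt_add_one hn).le
  unfold shellLevel
  push_cast
  linarith

/-- The number of cells of shell k up to a constant; rounding up and the added 2 cost at most 3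
levels, whence 2^(3l). -/
lemma pow_shellLevel_le (hγ' : 0 < γ') (hγs : γ' < s) (hs : 0 < s) (l : ℕ) :
    ((2 : ℝ) ^ shellLevel s γ' K k) ^ l * (1 / 2) ^ k ≤
      2 ^ (3 * l) * (((2 : ℝ) ^ (l * (s - γ') / s)) ^ K * ((2 : ℝ) ^ (l * γ' / s - 1)) ^ k) := by
  have hs' : (s : ℝ) ≠ 0 := by exact_mod_cast hs.ne'
  have h2 : (0 : ℝ) < 2 := by norm_num
  have e1 : ((2 : ℝ) ^ shellLevel s γ' K k) ^ l ≤
      (2 : ℝ) ^ ((((s - γ') * K + γ' * k) / s + 3) * l) := by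
    rw [Real.rpow_mul_natCast h2.le]
    refine pow_le_pow_left₀ (by positivity) ?_ l
    rw [← Real.rpow_natCast]
    exact Real.rpow_le_rpow_of_exponent_le one_le_two (shellLevel_le hγ' hγs)
  have e2 : (1 / 2 : ℝ) ^ k = (2 : ℝ) ^ (-(k : ℝ)) := by
    rw [Real.rpow_neg h2.le, Real.rpow_natCast, one_div, inv_pow]
  rw [← Real.rpow_mul_natCast h2.le, ← Real.rpow_mul_natCast h2.le,
    ← Real.rpow_natCast 2 (3 * l), ← Real.rpow_add h2, ← Real.rpow_add h2]
  calc _ ≤ (2 : ℝ) ^ ((((s - γ') * K + γ' * k) / s + 3) * l) * (1 / 2) ^ k := by gcongr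
    _ = _ := by
        rw [e2, ← Real.rpow_add h2]
        congr 1
        push_cast
        field_simp
        ring

end Levels

/-! ### Error against number of nodes for a graded mesh with free parameters. -/

section GradedApproximation

variable {l r u : ℕ} {γ γ' : ℝ}

/-- The levels balance the error over the shells up to the factor (k+1)^u 2^(-(γ'-γ)k), which W
dominates. A larger γ' improves W but puts more cells near the boundary; both regimes of the theorem
are instances. -/
lemma exists_graded_spline (hl : 0 < l) (hr : 0 < r) (hγ : 0 < γ) (hζ0 : 0 < (⌈γ⌉₊ : ℝ) - γ)
    (hζ : (⌈γ⌉₊ : ℝ) - γ ≤ 1) {s : ℕ} (hs : s = r + ⌈γ⌉₊) (hγγ' : γ ≤ γ') (hγ's : γ' < s) :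
    ∃ A B : ℝ, 0 < A ∧ 0 < B ∧ ∀ (K n : ℕ) (W : ℝ),
      (∀ k ≤ K, ((k : ℝ) + 1) ^ u * (1 / 2 : ℝ) ^ ((γ' - γ) * k) ≤ W) →
      A * ((2 : ℝ) ^ (l * (s - γ') / s)) ^ K *
        ∑ k ∈ Finset.range (K + 1), ((2 : ℝ) ^ (l * γ' / s - 1)) ^ k ≤ n →
      ∃ S : C(cube l, ℝ) →ₗ[ℝ] C(cube l, ℝ), IsLocalSplineMethod (s - 1) n S ∧
        ∀ f ∈ classQ l r u γ, ‖f - S f‖ ≤ B * ((1 / 2 : ℝ) ^ (s - γ')) ^ K * W := by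
  have hceil : 0 < ⌈γ⌉₊ := Nat.ceil_pos.2 hγ
  have hγ' : 0 < γ' := hγ.trans_le hγγ'
  have hq : 0 < s - 1 := by omega
  have hs0 : 0 < s := by omega
  set q := s - 1 with hqdef
  set b : ℝ := (1 / 2 : ℝ) ^ ((⌈γ⌉₊ : ℝ) - γ) with hb
  have hb0 : 0 < b := by positivity
  have hl' : (0 : ℝ) < l := by exact_mod_cast hl
  have hosc : 0 < oscConst l u b := by
    have : (0 : ℝ) ≤ ∑' j : ℕ, ((j : ℝ) + 2) ^ u * b ^ j := tsum_nonneg fun j => by positivity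
    unfold oscConst
    positivity
  have hΛ : 0 < lebesgueBound q := zero_lt_one.trans_le (one_le_lebesgueBound hq)
  set C : ℝ := 2 * 2 ^ u * 2 ^ γ + oscConst l u b with hC
  have hC0 : 0 < C := by positivity
  refine ⟨(q + 1) ^ l * (2 ^ l * l * 2 ^ (3 * l)),
    (1 + lebesgueBound q ^ l) * (l * lebesgueBound q ^ l * ((1 + lebesgueBound q) * C)),
    by positivity, by positivity, fun K n W hW hn => ?_⟩
  set p := shellLevel s γ' K with hp
  have hmono : Monotone p := monotone_shellLevel hγ'
  have hpk : ∀ k ≤ K, k + 2 ≤ p k := fun k hk => add_two_le_shellLevel hs0 hγ's hk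
  set τ : ℝ := (1 / 2 : ℝ) ^ (s - γ') with hτ
  have hτ0 : 0 < τ := by positivity
  have hW0 : 0 ≤ W := le_trans (by positivity) (hW 0 (Nat.zero_le K))
  have hhalf : (0 : ℝ) < 1 / 2 := by norm_num
  have hτK : τ ^ K = (1 / 2 : ℝ) ^ ((s - γ') * K) := (Real.rpow_mul_natCast hhalf.le _ _).symm
  refine ⟨splineOp l hq p K, isLocalSplineMethod_splineOp hl hq hmono hpk ?_, ?_⟩
  · have hcast : (((∑ k ∈ Finset.range (K + 1), (shellCells l p K k).card) * (q + 1) ^ l : ℕ) : ℝ) ≤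
        n := by
      refine le_trans ?_ hn
      push_cast
      have : ∑ k ∈ Finset.range (K + 1), ((shellCells l p K k).card : ℝ) ≤
          ∑ k ∈ Finset.range (K + 1), 2 ^ l * l * (2 ^ (3 * l) *
            (((2 : ℝ) ^ (l * (s - γ') / s)) ^ K * ((2 : ℝ) ^ (l * γ' / s - 1)) ^ k)) := by
        refine Finset.sum_le_sum fun k hk => ?_
        refine (card_shellCells_le (hpk k (by have := Finset.mem_range.1 hk; omega))).trans ?_
        exact mul_le_mul_of_nonneg_left (pow_shellLevel_le hγ' hγ's hs0 l) (by positivity)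
      calc _ ≤ (∑ k ∈ Finset.range (K + 1), 2 ^ l * l * (2 ^ (3 * l) *
            (((2 : ℝ) ^ (l * (s - γ') / s)) ^ K * ((2 : ℝ) ^ (l * γ' / s - 1)) ^ k))) *
              (q + 1) ^ l := by gcongr
        _ = _ := by rw [← Finset.mul_sum, ← Finset.mul_sum, ← Finset.mul_sum]; ring
    exact_mod_cast hcast
  · rintro f ⟨g, hgf, hg⟩
    have hF : ∀ t ∈ cube l, extendZero f t = g t := fun t ht => by
      rw [extendZero, dif_pos ht]; exact (hgf ⟨t, ht⟩).symm
    have hinner : ∀ k ≤ K, ((1 / 2 : ℝ) ^ p k) ^ s *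
        (2 * ((k + 1 : ℕ) + 1) ^ u * ((2 : ℝ) ^ γ) ^ (k + 1)) ≤ C * (τ ^ K * W) := by
      intro k hk
      have h1 : ((1 / 2 : ℝ) ^ p k) ^ s ≤ τ ^ K * (1 / 2 : ℝ) ^ (γ' * k) := by
        rw [hτK, ← Real.rpow_add hhalf, ← pow_mul, ← Real.rpow_natCast]
        refine Real.rpow_le_rpow_of_exponent_ge hhalf (by norm_num) ?_
        push_cast
        rw [mul_comm (p k : ℝ)]
        exact le_mul_shellLevel hs0
      have h2 : (((k + 1 : ℕ) : ℝ) + 1) ^ u ≤ 2 ^ u * ((k : ℝ) + 1) ^ u := by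
        rw [← mul_pow]
        refine pow_le_pow_left₀ (by positivity) ?_ u
        push_cast
        linarith [(Nat.cast_nonneg k : (0 : ℝ) ≤ k)]
      have h3 : (1 / 2 : ℝ) ^ (γ' * k) * ((2 : ℝ) ^ γ) ^ k = (1 / 2 : ℝ) ^ ((γ' - γ) * k) := by
        have : ((2 : ℝ) ^ γ) ^ k = (1 / 2 : ℝ) ^ (-(γ * k)) := by
          rw [← Real.rpow_mul_natCast (by norm_num), one_div, Real.inv_rpow (by norm_num),
            Real.rpow_neg (by norm_num), inv_inv]
        rw [this, ← Real.rpow_add hhalf]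
        congr 1
        ring
      calc _ ≤ (τ ^ K * (1 / 2 : ℝ) ^ (γ' * k)) *
            (2 * (2 ^ u * ((k : ℝ) + 1) ^ u) * ((2 : ℝ) ^ γ) ^ (k + 1)) := by gcongr
        _ = 2 * 2 ^ u * 2 ^ γ * (τ ^ K * (((k : ℝ) + 1) ^ u *
            ((1 / 2 : ℝ) ^ (γ' * k) * ((2 : ℝ) ^ γ) ^ k))) := by ring
        _ ≤ C * (τ ^ K * W) := by
            rw [h3]
            have : 2 * 2 ^ u * 2 ^ γ ≤ C := by linarith
            have := hW k hk
            gcongr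
    have houter : ((1 / 2 : ℝ) ^ p K) ^ r * (oscConst l u b * ((K + 1) ^ u * b ^ K)) ≤
        C * (τ ^ K * W) := by
      -- On the last shell edges of length 2^-K already suffice, since r + ζ = s - γ.
      have h1 : ((1 / 2 : ℝ) ^ p K) ^ r ≤ ((1 / 2 : ℝ) ^ K) ^ r := by
        refine pow_le_pow_left₀ (by positivity) ?_ r
        exact pow_le_pow_of_le_one (by norm_num) (by norm_num) (by have := hpk K le_rfl; omega)
      have h2 : ((1 / 2 : ℝ) ^ K) ^ r * b ^ K = τ ^ K * (1 / 2 : ℝ) ^ ((γ' - γ) * K) := by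
        rw [hτK, ← Real.rpow_add hhalf, hb, ← Real.rpow_mul_natCast hhalf.le, ← pow_mul,
          ← Real.rpow_natCast, ← Real.rpow_add hhalf]
        congr 1
        rw [hs]
        push_cast
        ring
      calc _ ≤ ((1 / 2 : ℝ) ^ K) ^ r * (oscConst l u b * ((K + 1) ^ u * b ^ K)) := by gcongr
        _ = oscConst l u b * (((K : ℝ) + 1) ^ u * (((1 / 2 : ℝ) ^ K) ^ r * b ^ K)) := by ring
        _ = oscConst l u b * (τ ^ K * (((K : ℝ) + 1) ^ u * (1 / 2 : ℝ) ^ ((γ' - γ) * K))) := by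
            rw [h2]; ring
        _ ≤ C * (τ ^ K * W) := by
            have : oscConst l u b ≤ C := by
              have : (0 : ℝ) < 2 * 2 ^ u * 2 ^ γ := by positivity
              linarith
            have := hW K le_rfl
            gcongr
    have hcell : ∀ k ≤ K, ∀ c ∈ shellCells l p K k, ∀ x ∈ gridCell (2 ^ p k) c,
        |extendZero f x - interp q (2 ^ p k) (extendZero f) x| ≤
          l * lebesgueBound q ^ l * ((1 + lebesgueBound q) * (C * (τ ^ K * W))) := by
      intro k hk c hc x hx
      rcases hk.lt_or_eq with hlt | rfl
      · refine (hg.abs_sub_interp_le_inner hl hq (by omega) hγ hζ hF (hpk k hk) hlt hc hx).trans ?_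
        rw [← hs]
        have := hinner k hk
        gcongr
      · refine (hg.abs_sub_interp_le_outer hl hq (by omega) hγ hζ hζ0 hF (hpk k hk) hc hx).trans ?_
        gcongr
    refine (ContinuousMap.norm_le _ (by positivity)).2 fun t => ?_
    obtain ⟨k, hk, c, hc, htc⟩ := exists_mem_shellCells hl hpk t.2
    have := abs_sub_gradedSpline_le hq hmono hpk hcell hk hc htc
    rw [extendZero_coe] at this
    calc _ = |f t - gradedSpline q p K (extendZero f) t| := rfl
      _ ≤ _ := this
      _ = _ := by ring

end GradedApproximation

/-! ### Choice of the number of shells in terms of n. -/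

section Asymptotics

variable {l r u : ℕ} {γ : ℝ}

lemma half_rpow_pow_eq {s : ℕ} {γ' : ℝ} (hl : 0 < l) (hs : 0 < s) (K : ℕ) :
    ((1 / 2 : ℝ) ^ (s - γ')) ^ K = (((2 : ℝ) ^ (l * (s - γ') / s)) ^ K) ^ (-(s : ℝ) / l) := by
  have hl' : (l : ℝ) ≠ 0 := by exact_mod_cast hl.ne'
  have hs' : (s : ℝ) ≠ 0 := by exact_mod_cast hs.ne'
  have h2 : (0 : ℝ) ≤ 2 := by norm_num
  rw [← Real.rpow_mul_natCast h2, ← Real.rpow_mul h2, ← Real.rpow_mul_natCast (by norm_num),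
    one_div, Real.inv_rpow h2, ← Real.rpow_neg h2]
  congr 1
  field_simp

/-- A γ' strictly between γ and s/l gives two convergent geometric effects: the cell counts sum to a
multiple of ρ^K, and (k+1)^u is absorbed by 2^(-(γ'-γ)k). -/
lemma exists_spline_bound_of_lt (hl : 0 < l) (hr : 0 < r) (hγ : 0 < γ)
    (hζ0 : 0 < (⌈γ⌉₊ : ℝ) - γ) (hζ : (⌈γ⌉₊ : ℝ) - γ ≤ 1) {s : ℕ} (hs : s = r + ⌈γ⌉₊)
    (h : γ * l < s) : ∃ c : ℝ, 0 < c ∧ ∀ n : ℕ, 1 ≤ n →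
      ∃ S : C(cube l, ℝ) →ₗ[ℝ] C(cube l, ℝ), IsLocalSplineMethod (s - 1) n S ∧
        ∀ f ∈ classQ l r u γ, ‖f - S f‖ ≤ c * (n : ℝ) ^ (-(s : ℝ) / l) := by
  have hs0 : 0 < s := by omega
  have hl' : (0 : ℝ) < l := by exact_mod_cast hl
  have hl1 : (1 : ℝ) ≤ l := by exact_mod_cast hl
  have hs' : (0 : ℝ) < s := by exact_mod_cast hs0
  obtain ⟨γ', hγγ', hγ'l⟩ := exists_between ((lt_div_iff₀ hl').2 h)
  rw [lt_div_iff₀ hl'] at hγ'l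
  have hγ's : γ' < s := by nlinarith
  obtain ⟨A, B, hA, hB, hAB⟩ := exists_graded_spline (u := u) hl hr hγ hζ0 hζ hs hγγ'.le hγ's
  set ρ : ℝ := (2 : ℝ) ^ (l * (s - γ') / s) with hρ
  set σ : ℝ := (2 : ℝ) ^ (l * γ' / s - 1) with hσ
  have hρ1 : 1 < ρ := Real.one_lt_rpow one_lt_two (by
    have : 0 < s - γ' := by linarith
    positivity)
  have hσ0 : 0 < σ := by positivity
  have hσ1 : σ < 1 := Real.rpow_lt_one_of_one_lt_of_neg one_lt_two (by
    have : l * γ' / s < 1 := by rw [div_lt_one hs']; linarith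
    linarith)
  set β : ℝ := (1 / 2 : ℝ) ^ (γ' - γ) with hβ
  have hβ0 : 0 < β := by positivity
  have hβ1 : β < 1 := Real.rpow_lt_one (by norm_num) (by norm_num) (by linarith)
  -- Any uniform bound for the terms would do; the sum of the series is one that is already at hand.
  set W : ℝ := ∑' j : ℕ, ((j : ℝ) + 2) ^ u * β ^ j with hW
  have hWk : ∀ k : ℕ, ((k : ℝ) + 1) ^ u * (1 / 2 : ℝ) ^ ((γ' - γ) * k) ≤ W := by
    intro k
    rw [Real.rpow_mul_natCast (by norm_num)]
    refine le_trans ?_ ((summable_pow_mul_geometric hβ0 hβ1 u).le_tsum k fun j _ => by positivity)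
    gcongr
    norm_num
  have hW0 : 0 < W := lt_of_lt_of_le (by positivity) (hWk 0)
  set D : ℝ := A * (1 - σ)⁻¹ with hD
  have hσ2 : 0 < 1 - σ := by linarith
  have hD0 : 0 < D := by positivity
  have hexp : -(s : ℝ) / l ≤ 0 := by
    rw [neg_div]; exact neg_nonpos.2 (by positivity)
  refine ⟨2 * (D ^ (-(s : ℝ) / l))⁻¹ + B * W * ((D * ρ) ^ (-(s : ℝ) / l))⁻¹, by positivity,
    fun n hn => ?_⟩
  have hn0 : (0 : ℝ) < n := by exact_mod_cast hn
  by_cases hnD : (n : ℝ) < D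
  · obtain ⟨S, hS, hSf⟩ := exists_constant_spline (l := l) (r := r) (u := u) (γ := γ) (s - 1) hn
    refine ⟨S, hS, fun f hf => (hSf f hf).trans ?_⟩
    have h1 : D ^ (-(s : ℝ) / l) ≤ (n : ℝ) ^ (-(s : ℝ) / l) :=
      Real.rpow_le_rpow_of_nonpos hn0 hnD.le hexp
    have h2 : (0 : ℝ) < D ^ (-(s : ℝ) / l) := by positivity
    calc (2 : ℝ) = 2 * (D ^ (-(s : ℝ) / l))⁻¹ * D ^ (-(s : ℝ) / l) := by field_simp
      _ ≤ (2 * (D ^ (-(s : ℝ) / l))⁻¹ + B * W * ((D * ρ) ^ (-(s : ℝ) / l))⁻¹) *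
          (n : ℝ) ^ (-(s : ℝ) / l) := by
        gcongr
        exact le_add_of_nonneg_right (by positivity)
  · rw [not_lt] at hnD
    -- K is the largest number of levels that the budget allows, so n and Dρ^K agree up to the
    -- factor ρ.
    obtain ⟨K, hK1, hK2⟩ := exists_nat_pow_near ((one_le_div hD0).2 hnD) hρ1
    rw [le_div_iff₀ hD0] at hK1
    rw [div_lt_iff₀ hD0] at hK2
    obtain ⟨S, hS, hSf⟩ := hAB K n W (fun k _ => hWk k) (by
      have hgeo : ∑ k ∈ Finset.range (K + 1), σ ^ k ≤ (1 - σ)⁻¹ :=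
        (summable_geometric_of_lt_one hσ0.le hσ1).sum_le_tsum _ (fun _ _ => by positivity) |>.trans
          (tsum_geometric_of_lt_one hσ0.le hσ1).le
      calc _ ≤ A * ρ ^ K * (1 - σ)⁻¹ := by gcongr
        _ = ρ ^ K * D := by rw [hD]; ring
        _ ≤ n := hK1)
    refine ⟨S, hS, fun f hf => (hSf f hf).trans ?_⟩
    have h1 : (ρ ^ K) ^ (-(s : ℝ) / l) ≤
        ((D * ρ) ^ (-(s : ℝ) / l))⁻¹ * (n : ℝ) ^ (-(s : ℝ) / l) := by
      have h2 : (n : ℝ) ≤ (D * ρ) * ρ ^ K := by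
        refine hK2.le.trans (le_of_eq ?_); rw [pow_succ]; ring
      have h3 := Real.rpow_le_rpow_of_nonpos hn0 h2 hexp
      rw [Real.mul_rpow (by positivity) (by positivity)] at h3
      have h4 : (0 : ℝ) < (D * ρ) ^ (-(s : ℝ) / l) := by positivity
      rw [inv_mul_eq_div, le_div_iff₀ h4]
      linarith
    rw [half_rpow_pow_eq hl hs0]
    calc _ ≤ B * (((D * ρ) ^ (-(s : ℝ) / l))⁻¹ * (n : ℝ) ^ (-(s : ℝ) / l)) * W := by gcongr
      _ = (B * W * ((D * ρ) ^ (-(s : ℝ) / l))⁻¹) * (n : ℝ) ^ (-(s : ℝ) / l) := by ring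
      _ ≤ _ := by
        gcongr
        exact le_add_of_nonneg_left (by positivity)

/-- With γ' = γ = s/l every shell has the same bound on its number of cells. The K + 1 shells
contribute (K+1)^(s/l) when the error is expressed through n, and the weight contributes (K+1)^u. -/
lemma exists_spline_bound_of_eq (hl : 0 < l) (hr : 0 < r) (hγ : 0 < γ)
    (hζ0 : 0 < (⌈γ⌉₊ : ℝ) - γ) (hζ : (⌈γ⌉₊ : ℝ) - γ ≤ 1) {s : ℕ} (hs : s = r + ⌈γ⌉₊)
    (h : γ * l = s) {e : ℝ} (he : u + s / l ≤ e) : ∃ c : ℝ, 0 < c ∧ ∀ n : ℕ, 2 ≤ n →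
      ∃ S : C(cube l, ℝ) →ₗ[ℝ] C(cube l, ℝ), IsLocalSplineMethod (s - 1) n S ∧
        ∀ f ∈ classQ l r u γ,
          ‖f - S f‖ ≤ c * (n : ℝ) ^ (-(s : ℝ) / l) * Real.log n ^ e := by
  have hs0 : 0 < s := by omega
  have hl' : (0 : ℝ) < l := by exact_mod_cast hl
  have hs' : (0 : ℝ) < s := by exact_mod_cast hs0
  have hγs : γ < s := by
    rw [hs]
    have hr' : (1 : ℝ) ≤ r := by exact_mod_cast hr
    push_cast
    linarith
  obtain ⟨A₀, B, hA₀, hB, hAB⟩ := exists_graded_spline (u := u) hl hr hγ hζ0 hζ hs le_rfl hγs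
  set ρ : ℝ := (2 : ℝ) ^ (l * (s - γ) / s) with hρ
  have hρ1 : 1 < ρ := Real.one_lt_rpow one_lt_two (by
    have : 0 < s - γ := by linarith
    positivity)
  have hσ : (2 : ℝ) ^ (l * γ / s - 1) = 1 := by
    rw [mul_comm, h, div_self hs'.ne', sub_self, Real.rpow_zero]
  -- A ≥ 1 ensures ρ^K ≤ n below, and so K is of order log n.
  set A : ℝ := max A₀ 1 with hAdef
  have hA1 : 1 ≤ A := le_max_right _ _
  have hA0 : 0 < A := by linarith
  have hlogρ : 0 < Real.log ρ := Real.log_pos hρ1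
  have hlog2 : 0 < Real.log 2 := Real.log_pos one_lt_two
  set M : ℝ := (Real.log ρ)⁻¹ + 2 * (Real.log 2)⁻¹ with hM
  have hM0 : 0 < M := by positivity
  have hexp : -(s : ℝ) / l ≤ 0 := by
    rw [neg_div]; exact neg_nonpos.2 (by positivity)
  have he0 : 0 ≤ e := le_trans (by positivity) he
  set c₁ : ℝ := 2 * (A ^ (-(s : ℝ) / l))⁻¹ * (Real.log 2 ^ e)⁻¹ with hc₁
  set c₂ : ℝ := B * ((A * ρ) ^ (-(s : ℝ) / l))⁻¹ * M ^ e with hc₂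
  have hc₁0 : 0 < c₁ := by positivity
  have hc₂0 : 0 < c₂ := by positivity
  refine ⟨c₁ + c₂, by positivity, fun n hn => ?_⟩
  have hn0 : (0 : ℝ) < n := by exact_mod_cast (by omega : 0 < n)
  have hn2 : (2 : ℝ) ≤ n := by exact_mod_cast hn
  have hlogn : Real.log 2 ≤ Real.log n := Real.log_le_log two_pos hn2
  have hlogn0 : 0 < Real.log n := hlog2.trans_le hlogn
  by_cases hnA : (n : ℝ) < A
  · obtain ⟨S, hS, hSf⟩ := exists_constant_spline (l := l) (r := r) (u := u) (γ := γ) (s - 1)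
      (by omega : 1 ≤ n)
    refine ⟨S, hS, fun f hf => (hSf f hf).trans ?_⟩
    have h1 : A ^ (-(s : ℝ) / l) ≤ (n : ℝ) ^ (-(s : ℝ) / l) :=
      Real.rpow_le_rpow_of_nonpos hn0 hnA.le hexp
    have h2 : (0 : ℝ) < A ^ (-(s : ℝ) / l) := by positivity
    have h3 : Real.log 2 ^ e ≤ Real.log n ^ e := Real.rpow_le_rpow hlog2.le hlogn he0
    have h4 : 0 < Real.log 2 ^ e := by positivity
    calc (2 : ℝ) = c₁ * A ^ (-(s : ℝ) / l) * Real.log 2 ^ e := by rw [hc₁]; field_simp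
      _ ≤ (c₁ + c₂) * (n : ℝ) ^ (-(s : ℝ) / l) * Real.log n ^ e := by
        gcongr
        exact le_add_of_nonneg_right hc₂0.le
  · rw [not_lt] at hnA
    have hex : ∃ K : ℕ, (n : ℝ) < A * ρ ^ K * (K + 1) := by
      obtain ⟨K, hK⟩ := pow_unbounded_of_one_lt (n : ℝ) hρ1
      refine ⟨K, hK.trans_le ?_⟩
      have h1 : ρ ^ K ≤ A * ρ ^ K := le_mul_of_one_le_left (by positivity) hA1
      refine h1.trans (le_mul_of_one_le_right (by positivity) ?_)
      linarith [(Nat.cast_nonneg K : (0 : ℝ) ≤ K)]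
    -- The predecessor of the first K that exceeds the budget; that first K is not 0 because n ≥ A.
    obtain ⟨K, hK1, hK2⟩ : ∃ K : ℕ, A * ρ ^ K * (K + 1) ≤ n ∧
        (n : ℝ) < A * ρ ^ (K + 1) * (K + 2) := by
      classical
      have hspec := Nat.find_spec hex
      have hmin := fun m => Nat.find_min hex (m := m)
      rcases hfind : Nat.find hex with _ | K
      · rw [hfind] at hspec
        simp only [pow_zero, mul_one, Nat.cast_zero, zero_add] at hspec
        exact absurd hspec (not_lt.2 hnA)
      · rw [hfind] at hspec hmin
        refine ⟨K, not_lt.1 (hmin K (Nat.lt_succ_self K)), hspec.trans_le (le_of_eq ?_)⟩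
        push_cast
        ring
    have hK0 : (0 : ℝ) ≤ K := Nat.cast_nonneg K
    obtain ⟨S, hS, hSf⟩ := hAB K n ((K + 1) ^ u) (fun k hk => by
      have : (k : ℝ) ≤ K := by exact_mod_cast hk
      rw [sub_self, zero_mul, Real.rpow_zero, mul_one]
      gcongr) (by
      rw [hσ]
      simp only [one_pow, Finset.sum_const, Finset.card_range, nsmul_eq_mul, mul_one]
      push_cast
      refine le_trans ?_ hK1
      have : A₀ ≤ A := le_max_left _ _
      gcongr)
    refine ⟨S, hS, fun f hf => (hSf f hf).trans ?_⟩
    have hKlog : (K : ℝ) + 2 ≤ M * Real.log n := by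
      have h1 : ρ ^ K ≤ n := by
        refine le_trans ?_ hK1
        have h1 : ρ ^ K ≤ A * ρ ^ K := le_mul_of_one_le_left (by positivity) hA1
        exact h1.trans (le_mul_of_one_le_right (by positivity) (by linarith))
      have h2 : K * Real.log ρ ≤ Real.log n := by
        rw [← Real.log_pow]; exact Real.log_le_log (by positivity) h1
      have h3 : (K : ℝ) ≤ (Real.log ρ)⁻¹ * Real.log n := by
        rw [inv_mul_eq_div, le_div_iff₀ hlogρ]; exact h2
      have h4 : 1 ≤ (Real.log 2)⁻¹ * Real.log n := by
        rw [inv_mul_eq_div, one_le_div hlog2]; exact hlogn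
      rw [hM, add_mul]
      linarith
    have h1 : (ρ ^ K) ^ (-(s : ℝ) / l) ≤
        ((A * ρ) ^ (-(s : ℝ) / l))⁻¹ * (n : ℝ) ^ (-(s : ℝ) / l) * ((K : ℝ) + 2) ^ ((s : ℝ) / l) := by
      have h2 : (n : ℝ) ≤ (A * ρ) * ρ ^ K * (K + 2) := by
        refine hK2.le.trans (le_of_eq ?_); rw [pow_succ]; ring
      have h3 := Real.rpow_le_rpow_of_nonpos hn0 h2 hexp
      rw [Real.mul_rpow (by positivity) (by positivity),
        Real.mul_rpow (by positivity) (by positivity), neg_div,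
        Real.rpow_neg (by positivity : (0 : ℝ) ≤ (K : ℝ) + 2), ← neg_div] at h3
      have h4 : (0 : ℝ) < (A * ρ) ^ (-(s : ℝ) / l) := by positivity
      have h5 : (0 : ℝ) < ((K : ℝ) + 2) ^ ((s : ℝ) / l) := by positivity
      rw [← div_eq_mul_inv, div_le_iff₀ h5] at h3
      rw [mul_assoc, inv_mul_eq_div, le_div_iff₀ h4]
      linarith
    have h6 : ((K : ℝ) + 2) ^ ((s : ℝ) / l) * (K + 1) ^ u ≤ M ^ e * Real.log n ^ e := by
      calc ((K : ℝ) + 2) ^ ((s : ℝ) / l) * (K + 1) ^ u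
          ≤ ((K : ℝ) + 2) ^ ((s : ℝ) / l) * (K + 2) ^ u := by gcongr; norm_num
        _ = ((K : ℝ) + 2) ^ (u + (s : ℝ) / l) := by
            rw [Real.rpow_add (by positivity), Real.rpow_natCast, mul_comm]
        _ ≤ ((K : ℝ) + 2) ^ e := Real.rpow_le_rpow_of_exponent_le (by linarith) he
        _ ≤ (M * Real.log n) ^ e := Real.rpow_le_rpow (by positivity) hKlog he0
        _ = M ^ e * Real.log n ^ e := Real.mul_rpow hM0.le hlogn0.le
    rw [half_rpow_pow_eq hl hs0]
    calc _ ≤ B * (((A * ρ) ^ (-(s : ℝ) / l))⁻¹ * (n : ℝ) ^ (-(s : ℝ) / l) *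
          ((K : ℝ) + 2) ^ ((s : ℝ) / l)) * (K + 1) ^ u := by gcongr
      _ = B * ((A * ρ) ^ (-(s : ℝ) / l))⁻¹ * (n : ℝ) ^ (-(s : ℝ) / l) *
          (((K : ℝ) + 2) ^ ((s : ℝ) / l) * (K + 1) ^ u) := by ring
      _ ≤ B * ((A * ρ) ^ (-(s : ℝ) / l))⁻¹ * (n : ℝ) ^ (-(s : ℝ) / l) *
          (M ^ e * Real.log n ^ e) := by gcongr
      _ = c₂ * (n : ℝ) ^ (-(s : ℝ) / l) * Real.log n ^ e := by rw [hc₂]; ring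
      _ ≤ _ := by
        gcongr
        exact le_add_of_nonneg_left hc₁0.le

end Asymptotics

end

theorem theorem3p4 (l r u s : ℕ) (γ v μ : ℝ) (hl : 2 ≤ l) (hr : 0 < r) (hu : 0 < u)
    (hγ : 0 < γ) (hγZ : ∀ m : ℤ, γ ≠ m) (hs : s = r + ⌈γ⌉₊)
    (hv : v = s / (s - γ)) (hμ : μ = 1 + γ - ⌈γ⌉₊) :
    (v < (l : ℝ) / (l - 1) →
      ∃ c : ℝ, 0 < c ∧ ∀ n : ℕ, 1 ≤ n →
        WidthAndSplineBound l r u γ (s - 1) n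
          (c * (n : ℝ) ^ (-(s : ℝ) / l))) ∧
    (v = (l : ℝ) / (l - 1) →
      ((l : ℝ) * u / (r + 1 - μ) ≥ (u : ℝ) * l / s + 1 →
        ∃ c : ℝ, 0 < c ∧ ∀ n : ℕ, 2 ≤ n →
          WidthAndSplineBound l r u γ (s - 1) n
            (c * (n : ℝ) ^ (-(s : ℝ) / l) * Real.log n ^ ((u : ℝ) * s / (r + 1 - μ)))) ∧
      ((l : ℝ) * u / (r + 1 - μ) < (u : ℝ) * l / s + 1 →
        ∃ c : ℝ, 0 < c ∧ ∀ n : ℕ, 2 ≤ n →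
          WidthAndSplineBound l r u γ (s - 1) n
            (c * (n : ℝ) ^ (-(s : ℝ) / l) * Real.log n ^ (((u : ℝ) * l + s) / l)))) := by
  have hl0 : 0 < l := by omega
  have hl2 : (2 : ℝ) ≤ l := by exact_mod_cast hl
  have hr1 : (1 : ℝ) ≤ r := by exact_mod_cast hr
  have hs' : (s : ℝ) = r + ⌈γ⌉₊ := by rw [hs]; push_cast; rfl
  have hζ : (⌈γ⌉₊ : ℝ) - γ ≤ 1 := by linarith [Nat.ceil_lt_add_one hγ.le]
  -- Here γ being no integer matters: ζ > 0 makes the series in the modulus of continuity converge.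
  have hζ0 : 0 < (⌈γ⌉₊ : ℝ) - γ := by
    have h1 := Nat.le_ceil γ
    have h2 : γ ≠ (⌈γ⌉₊ : ℝ) := by exact_mod_cast hγZ (⌈γ⌉₊ : ℤ)
    have := lt_of_le_of_ne h1 h2
    linarith
  have hsγ : 0 < s - γ := by linarith
  have hs0 : (0 : ℝ) < s := by linarith
  have hl1 : (0 : ℝ) < (l : ℝ) - 1 := by linarith
  refine ⟨fun hlt => ?_, fun heq => ?_⟩
  -- Cross-multiplied, s(l - 1) < l(s - γ) is γl < s; with equality below it becomes γl = s.
  · rw [hv, div_lt_div_iff₀ hsγ hl1] at hlt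
    obtain ⟨c, hc, hcn⟩ := exists_spline_bound_of_lt (u := u) hl0 hr hγ hζ0 hζ hs (by linarith)
    refine ⟨c, hc, fun n hn => ?_⟩
    obtain ⟨S, hS, hSf⟩ := hcn n hn
    exact widthAndSplineBound_of_spline hl0 hS hSf
  · rw [hv, div_eq_div_iff hsγ.ne' hl1.ne'] at heq
    have hden : (r : ℝ) + 1 - μ = s - γ := by rw [hμ, hs']; ring
    have key : ∀ e : ℝ, (u : ℝ) + s / l ≤ e → ∃ c : ℝ, 0 < c ∧ ∀ n : ℕ, 2 ≤ n →
        WidthAndSplineBound l r u γ (s - 1) n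
          (c * (n : ℝ) ^ (-(s : ℝ) / l) * Real.log n ^ e) := by
      intro e he
      obtain ⟨c, hc, hcn⟩ :=
        exists_spline_bound_of_eq (u := u) hl0 hr hγ hζ0 hζ hs (by linarith) he
      refine ⟨c, hc, fun n hn => ?_⟩
      obtain ⟨S, hS, hSf⟩ := hcn n hn
      exact widthAndSplineBound_of_spline hl0 hS hSf
    refine ⟨fun h => key _ ?_, fun _ => key _ (le_of_eq ?_)⟩
    -- Multiplying the case condition by s/l turns it into u + s/l ≤ us/(s - γ), so this exponent is
    -- admissible in `key`.
    · rw [hden] at h ⊢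
      have h1 := mul_le_mul_of_nonneg_right h.le (by positivity : (0 : ℝ) ≤ s / l)
      calc (u : ℝ) + s / l = ((u : ℝ) * l / s + 1) * (s / l) := by field_simp
        _ ≤ l * u / (s - γ) * (s / l) := h1
        _ = u * s / (s - γ) := by field_simp
    · field_simp
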